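/- Setting. Let $\mathcal A$ (actions) and $\mathcal E$ (percepts) be finite alphabets and $\Sigma=\mathcal A\sqcup\mathcal E$. A probabilistic oracle Turing machine (pTM) $T$ may flip fair coins and may put queries $(T',x,p,\alpha)$ to an oracle, where $T'$ is a pTM, $x\in\Sigma^*$, $p\in\mathbb Q\cap[0,1]$, $\alpha\in\mathcal A$; an oracle $O$ assigns to each query the probability $O_\alpha(T',x,p)\in[0,1]$ with which it answers $1$ (otherwise it answers $0$), all answers being independent. Let $\lambda_T^O(\alpha\mid x)$ be the probability that $T$ with oracle $O$ on input $x$ halts with output $\alpha$. The oracle $O$ is *reflective* if for every pTM $T$ and every $x\in\Sigma^*$ there are reals $(q_\alpha)_{\alpha\in\mathcal A}$ with $\sum_\alpha q_\alpha=1$ such that for all $\alpha\in\mathcal A$ and all $p\in\mathbb Q\cap[0,1]$: $\lambda_T^O(\alpha\mid x)\le q_\alpha\le 1-\sum_{\beta\ne\alpha}\lambda_T^O(\beta\mid x)$; $O_\alpha(T,x,p)=1$ if $p<q_\alpha$; and $O_\alpha(T,x,p)=0$ if $p>q_\alpha$. A real-valued function $f$ is *estimable* if there is a computable rational-valued $\varphi$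 with $|f(x)-\varphi(x,k)|<1/k$ for all $x$ and all $k\ge1$. It is *$O$-estimable* if there is a pTM that with oracle $O$, on every input $(x,k)$, halts with probability one and outputs a rational number within $1/k$ of $f(x)$ (strictly). A strategy $\pi$ gives for every history $h\in(\mathcal A\times\mathcal E)^*$ a probability distribution $\pi(\cdot\mid h)$ on $\mathcal A$; it is *reflective-oracle computable* (with respect to $O$) if for some pTM $T$, $\pi(a\mid h)=\lambda_T^O(a\mid h)$ for all $h$ and $a$. An environment $\nu$ is specified by probability distributions $\nu(\cdot\mid ha)$ on $\mathcal E$, for all actions $a$ and all histories $h$ in a set $\mathcal H_\nu$ that contains the empty history and contains $hae$ whenever $h\in\mathcal H_\nu$ and $\nu(e\mid ha)>0$. (So $\mathcal H_\nu$ may consist of all histories, or only of those to which $\nu$ gives positive probability.) Its conditionals are $O$-estimable if $(h,a,e)\mapsto\nu(e\mid ha)$ is $O$-estimable on $\mathcal H_\nu\times\mathcal A\times\mathcal E$. Each percept $e$ carries a reward $r(e)\in[0,1]$, and $r$ is estimable. Let $\gamma_t\ge0$ with $\sum_t\gamma_t<\infty$ and $\Gamma_t=\sum_{i\ge t}\gamma_i$.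 For a history $h_{<t}\in\mathcal H_\nu$ of length $t-1$ the value of $\pi$ in $\nu$ is $$V_\nu^\pi(h_{<t})=\frac1{\Gamma_t}\lim_{m\to\infty}\sum_{a_te_t\dots a_me_m}\Big(\sum_{i=t}^m\gamma_i\,r(e_i)\Big)\prod_{j=t}^m\pi(a_j\mid h_{<t}a_te_t\dots a_{j-1}e_{j-1})\,\nu(e_j\mid h_{<t}a_te_t\dots a_{j-1}e_{j-1}a_j),$$ where products containing a factor $\nu(\cdot\mid\cdot)=0$ are $0$, and $V_\nu^\pi(h_{<t})=0$ if $\Gamma_t=0$. A strategy $\pi$ is *optimal* for $\nu$ if $V_\nu^{\pi'}(h)\le V_\nu^{\pi}(h)$ for every strategy $\pi'$ and every $h\in\mathcal H_\nu$. Theorem (oracle-computable optimal strategy). Let $O$ be a reflective oracle, let $\nu$ be an environment whose conditionals are $O$-estimable, and let the discount normalization factor $t\mapsto\Gamma_t$ be estimable. Then there is a reflective-oracle computable strategy $\pi^*_\nu$ that is optimal for $\nu$. -/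

import Mathlib

/-! # Probabilistic oracle machines, reflective oracles, and optimal strategies

Throughout, `A` is the finite set of actions, `E` is the finite set of percepts, and machines work
over the alphabet `A ⊕ E`.  Time is counted from `0`: the round played after a history of length `t`
is round number `t`. -/

/-! ## Estimable functions -/

/-- The rational number `z / (n + 1)` coded by the pair `(z, n)`.  Every rational has a code. -/
def ratOfCode (c : ℤ × ℕ) : ℚ := (c.1 : ℚ) / ((c.2 : ℚ) + 1)

/-- A real-valued function is estimable if a computable rational-valued function of `x` and of the
precision `k` approximates it to within `1 / (k + 1)`. -/
def Estimable {α : Type*} [Primcodable α] (f : α → ℝ) : Prop :=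
  ∃ φ : α × ℕ → ℤ × ℕ, Computable φ ∧
    ∀ x k, |f x - (ratOfCode (φ (x, k)) : ℝ)| < 1 / ((k : ℝ) + 1)

/-! ## Probabilistic oracle machines -/

/-- Descriptions of probabilistic oracle machines (pTMs).  The deterministic part of a machine is a
program for a partial recursive function.  Given the input and all the bits the machine has
received so far (coin flips and oracle answers), the program computes the next action of the
machine that is not an internal computation step: flip a fair coin, put a query to the oracle, or
halt with an output.  If the program diverges, so does the machine. -/
abbrev PTM : Type := Nat.Partrec.Code

/-- A raw oracle query `(T, x, c, α)`: it asks whether the machine `T` on the string `x` outputs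
`α` with probability more than `p`, where `p` is the rational with code `c`. -/
abbrev Query (A E : Type*) : Type _ := PTM × List (A ⊕ E) × (ℤ × ℕ) × A

/-- The actions of a machine: put a query to the oracle, halt with an output (outputs, like inputs,
are coded by natural numbers), or flip a fair coin. -/
abbrev MachineAction (A E : Type*) : Type _ := Query A E ⊕ (ℕ ⊕ Unit)

/-- An oracle assigns to a query its probability of answering `1`. -/
abbrev Oracle (A E : Type*) : Type _ :=
  PTM → List (A ⊕ E) → Set.Icc (0 : ℚ) 1 → A → Set.Icc (0 : ℝ) 1

/-- The probability that the oracle answers `1` to a raw query.  The rational written by the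
machine is projected to `[0, 1]`, so that every query is a valid one. -/
def Oracle.answerProb {A E : Type*} (O : Oracle A E) (q : Query A E) : ℝ :=
  (O q.1 q.2.1 (Set.projIcc 0 1 zero_le_one (ratOfCode q.2.2.1)) q.2.2.2 : ℝ)

/-- The next action of `T` on the input coded by `input`, when `bits` are the coin flips and oracle
answers received so far, the most recent one first.  It is `none` if the program diverges or
does not return a valid action. -/
noncomputable def PTM.next (A E : Type*) [Primcodable A] [Primcodable E]
    (T : PTM) (input : ℕ) (bits : List Bool) : Option (MachineAction A E) :=
  open Classical in
  (T.eval (Encodable.encode (input, bits))).toOption.bind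
    (Encodable.decode (α := MachineAction A E))

/-- The probability that `T` with oracle `O`, having received `bits`, halts with an output in `S`
before receiving `n` further bits.  All coin flips and oracle answers are independent. -/
noncomputable def haltProbIn {A E : Type*} [Primcodable A] [Primcodable E] (O : Oracle A E)
    (T : PTM) (input : ℕ) (S : Set ℕ) : ℕ → List Bool → ℝ
  | 0, _ => 0
  | n + 1, bits =>
    match PTM.next A E T input bits with
    | none => 0
    | some (.inl q) =>
        O.answerProb q * haltProbIn O T input S n (true :: bits)
          + (1 - O.answerProb q) * haltProbIn O T input S n (false :: bits)
    | some (.inr (.inl m)) => S.indicator (fun _ => 1) m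
    | some (.inr (.inr _)) =>
        1 / 2 * haltProbIn O T input S n (true :: bits)
          + 1 / 2 * haltProbIn O T input S n (false :: bits)

/-- The probability that `T` with oracle `O` halts on the given input with an output in `S`.  It is
the limit of the increasing sequence of the probabilities of doing so within `n` bits. -/
noncomputable def haltProb {A E : Type*} [Primcodable A] [Primcodable E] (O : Oracle A E)
    (T : PTM) (input : ℕ) (S : Set ℕ) : ℝ :=
  ⨆ n, haltProbIn O T input S n []

theorem Oracle.answerProb_mem {A E : Type*} (O : Oracle A E) (q : Query A E) :
    0 ≤ O.answerProb q ∧ O.answerProb q ≤ 1 :=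
  (O q.1 q.2.1 (Set.projIcc 0 1 zero_le_one (ratOfCode q.2.2.1)) q.2.2.2).2

theorem haltProbIn_mem {A E : Type*} [Primcodable A] [Primcodable E] (O : Oracle A E)
    (T : PTM) (input : ℕ) (S : Set ℕ) (n : ℕ) (bits : List Bool) :
    0 ≤ haltProbIn O T input S n bits ∧ haltProbIn O T input S n bits ≤ 1 := by
  induction n generalizing bits with
  | zero => simp [haltProbIn]
  | succ n ih =>
    have h1 := ih (true :: bits)
    have h0 := ih (false :: bits)
    rw [haltProbIn]
    split
    · simp
    · rename_i q _
      have hq := O.answerProb_mem q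
      constructor <;> nlinarith
    · rename_i m _
      by_cases hm : m ∈ S <;> simp [hm]
    · constructor <;> linarith

theorem haltProbIn_le_succ {A E : Type*} [Primcodable A] [Primcodable E] (O : Oracle A E)
    (T : PTM) (input : ℕ) (S : Set ℕ) (n : ℕ) (bits : List Bool) :
    haltProbIn O T input S n bits ≤ haltProbIn O T input S (n + 1) bits := by
  induction n generalizing bits with
  | zero => exact (haltProbIn_mem O T input S 1 bits).1
  | succ n ih =>
    have h1 := ih (true :: bits)
    have h0 := ih (false :: bits)
    rw [haltProbIn, haltProbIn]
    split
    · simp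
    · rename_i q _
      have hq := O.answerProb_mem q
      nlinarith
    · simp
    · linarith

/-- The supremum in `haltProb` is the limit of the probabilities of halting within `n` bits. -/
theorem tendsto_haltProbIn {A E : Type*} [Primcodable A] [Primcodable E] (O : Oracle A E)
    (T : PTM) (input : ℕ) (S : Set ℕ) :
    Filter.Tendsto (fun n => haltProbIn O T input S n []) Filter.atTop
      (nhds (haltProb O T input S)) :=
  tendsto_atTop_ciSup (monotone_nat_of_le_succ fun n => haltProbIn_le_succ O T input S n [])
    ⟨1, by rintro _ ⟨n, rfl⟩; exact (haltProbIn_mem O T input S n []).2⟩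

/-- `lam O T s x` is `λ_T^O(s | x)`, the probability that `T` with oracle `O` outputs the symbol
`s` on the input string `x`. -/
noncomputable def lam {A E : Type*} [Primcodable A] [Primcodable E] (O : Oracle A E)
    (T : PTM) (s : A ⊕ E) (x : List (A ⊕ E)) : ℝ :=
  haltProb O T (Encodable.encode x) {Encodable.encode s}

/-- Reflective oracles with output alphabet `A` and input alphabet `A ⊕ E`. -/
def Oracle.IsReflective {A E : Type*} [Fintype A] [Primcodable A] [Primcodable E]
    (O : Oracle A E) : Prop :=
  open Classical in
  ∀ (T : PTM) (x : List (A ⊕ E)), ∃ q : A → ℝ,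
    ∑ a, q a = 1 ∧
    ∀ a, lam O T (.inl a) x ≤ q a ∧
      q a ≤ 1 - ∑ b ∈ Finset.univ.erase a, lam O T (.inl b) x ∧
      ∀ p : Set.Icc (0 : ℚ) 1,
        (((p : ℚ) : ℝ) < q a → (O T x p a : ℝ) = 1) ∧
        (q a < ((p : ℚ) : ℝ) → (O T x p a : ℝ) = 0)

/-- The function `f` is estimable on `D` with access to `O`: there is a pTM that on every input
`(x, k)` with `x ∈ D` halts with probability one and returns (the code of) a rational number
within `1 / (k + 1)` of `f x`. -/
def OEstimableOn {A E : Type*} [Primcodable A] [Primcodable E] (O : Oracle A E)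
    {α : Type*} [Primcodable α] (D : Set α) (f : α → ℝ) : Prop :=
  ∃ T : PTM, ∀ x ∈ D, ∀ k : ℕ,
    haltProb O T (Encodable.encode (x, k))
      {m | ∃ c : ℤ × ℕ, Encodable.encode c = m ∧
        |f x - (ratOfCode c : ℝ)| < 1 / ((k : ℝ) + 1)} = 1

/-! ## Environments and strategies -/

/-- An environment, specified by its conditional probabilities `cond h a e = ν(e | h a)`.  They are
probability distributions for all histories `h` in a set `dom` (and are meaningless outside `dom`)
that contains the empty history and is closed under continuations of positive conditional
probability, so that it contains every history of positive probability.  The least possible `dom`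
is the set of histories of positive probability, the largest one consists of all histories. -/
structure Environment (A E : Type*) [Fintype E] where
  dom : Set (List (A × E))
  cond : List (A × E) → A → E → ℝ
  nil_mem : [] ∈ dom
  cond_nonneg : ∀ h ∈ dom, ∀ a e, 0 ≤ cond h a e
  cond_sum : ∀ h ∈ dom, ∀ a, ∑ e, cond h a e = 1
  append_mem : ∀ h ∈ dom, ∀ a e, 0 < cond h a e → h ++ [(a, e)] ∈ dom

/-- The conditional probabilities `ν(e | h a)`, as a function of `(h, a, e)` with `h` ranging over
the histories at which they are specified, are estimable with access to `O`. -/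
def Environment.OEstimableConditionals {A E : Type*} [Primcodable A] [Fintype E] [Primcodable E]
    (ν : Environment A E) (O : Oracle A E) : Prop :=
  OEstimableOn O {z : List (A × E) × A × E | z.1 ∈ ν.dom} fun z => ν.cond z.1 z.2.1 z.2.2

/-- A strategy assigns to every history a probability distribution `prob h` on actions. -/
structure Strategy (A E : Type*) [Fintype A] where
  prob : List (A × E) → A → ℝ
  prob_nonneg : ∀ h a, 0 ≤ prob h a
  prob_sum : ∀ h, ∑ a, prob h a = 1

/-- The history `a₁e₁a₂e₂...` written as a string over `A ⊕ E`. -/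
def historyString {A E : Type*} (h : List (A × E)) : List (A ⊕ E) :=
  h.flatMap fun z => [.inl z.1, .inr z.2]

/-- A strategy is reflective-oracle computable if a pTM with oracle `O` samples from it. -/
def Strategy.IsReflectiveOracleComputable {A E : Type*} [Fintype A] [Primcodable A] [Primcodable E]
    (π : Strategy A E) (O : Oracle A E) : Prop :=
  ∃ T : PTM, ∀ (h : List (A × E)) (a : A), π.prob h a = lam O T (.inl a) (historyString h)

/-! ## Values and optimality -/

/-- The discount normalization factor `Γ_t = γ_t + γ_{t+1} + ...`. -/
noncomputable def discountNorm (γ : ℕ → ℝ) (t : ℕ) : ℝ := ∑' i, γ (t + i)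

/-- The probability that `π` and `ν` continue the history `h` by `w`. -/
noncomputable def contProb {A E : Type*} [Fintype A] [Fintype E] (ν : Environment A E)
    (π : Strategy A E) (h : List (A × E)) {n : ℕ} (w : Fin n → A × E) : ℝ :=
  ∏ j : Fin n, π.prob (h ++ (List.ofFn w).take j) (w j).1 *
    ν.cond (h ++ (List.ofFn w).take j) (w j).1 (w j).2

/-- The expected discounted reward sum over the `n` rounds following the history `h`. -/
noncomputable def partialValue {A E : Type*} [Fintype A] [Fintype E] (γ : ℕ → ℝ) (r : E → ℝ)
    (ν : Environment A E) (π : Strategy A E) (h : List (A × E)) (n : ℕ) : ℝ :=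
  ∑ w : Fin n → A × E, (∑ i : Fin n, γ (h.length + i) * r (w i).2) * contProb ν π h w

/-- The value function `V_ν^π(h)`.  (If the normalization factor is `0`, all discounted rewards
vanish from then on, and the value is `0`.) -/
noncomputable def value {A E : Type*} [Fintype A] [Fintype E] (γ : ℕ → ℝ) (r : E → ℝ)
    (ν : Environment A E) (π : Strategy A E) (h : List (A × E)) : ℝ :=
  1 / discountNorm γ h.length *
    Filter.limUnder Filter.atTop (partialValue γ r ν π h)

/-- A strategy is optimal for `ν` if it maximizes the value at every history at which `ν` is
specified. -/
def Strategy.IsOptimal {A E : Type*} [Fintype A] [Fintype E] (π : Strategy A E) (γ : ℕ → ℝ)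
    (r : E → ℝ) (ν : Environment A E) : Prop :=
  ∀ h ∈ ν.dom, ∀ π' : Strategy A E, value γ r ν π' h ≤ value γ r ν π h

/-! The limit that defines the value exists. -/

theorem contProb_snoc {A E : Type*} [Fintype A] [Fintype E] (ν : Environment A E)
    (π : Strategy A E) (h : List (A × E)) {n : ℕ} (w : Fin n → A × E) (z : A × E) :
    contProb ν π h (Fin.snoc (α := fun _ => A × E) w z) =
      contProb ν π h w *
        (π.prob (h ++ List.ofFn w) z.1 * ν.cond (h ++ List.ofFn w) z.1 z.2) := by
  have hl : List.ofFn (Fin.snoc (α := fun _ => A × E) w z) = List.ofFn w ++ [z] := by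
    rw [List.ofFn_succ']
    simp
  unfold contProb
  rw [Fin.prod_univ_castSucc]
  congr 1
  · refine Finset.prod_congr rfl fun j _ => ?_
    have ht : (List.ofFn w ++ [z]).take (j : ℕ) = (List.ofFn w).take j :=
      List.take_append_of_le_length (by simp [j.2.le])
    simp only [hl, Fin.snoc_castSucc, Fin.val_castSucc, ht]
  · have ht : (List.ofFn w ++ [z]).take n = List.ofFn w := by simp
    simp only [hl, Fin.snoc_last, Fin.val_last, ht]

theorem contProb_nonneg_and_mem {A E : Type*} [Fintype A] [Fintype E] (ν : Environment A E)
    (π : Strategy A E) (h : List (A × E)) (hh : h ∈ ν.dom) {n : ℕ} (w : Fin n → A × E) :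
    0 ≤ contProb ν π h w ∧ (0 < contProb ν π h w → h ++ List.ofFn w ∈ ν.dom) := by
  induction n with
  | zero => simp [contProb, hh]
  | succ n ih =>
    obtain ⟨p, rfl⟩ := (Fin.snocEquiv fun _ : Fin (n + 1) => A × E).surjective w
    obtain ⟨z, w⟩ := p
    change 0 ≤ contProb ν π h (Fin.snoc (α := fun _ => A × E) w z) ∧
      (0 < contProb ν π h (Fin.snoc (α := fun _ => A × E) w z) →
        h ++ List.ofFn (Fin.snoc (α := fun _ => A × E) w z) ∈ ν.dom)
    have hl : List.ofFn (Fin.snoc (α := fun _ => A × E) w z) = List.ofFn w ++ [z] := by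
      rw [List.ofFn_succ']
      simp
    rw [contProb_snoc, hl, ← List.append_assoc]
    obtain ⟨h0, h1⟩ := ih w
    rcases h0.eq_or_lt with h0 | h0
    · simp [← h0]
    · have hd := h1 h0
      have hc := ν.cond_nonneg _ hd z.1 z.2
      have hp := π.prob_nonneg (h ++ List.ofFn w) z.1
      refine ⟨by positivity, fun hpos => ?_⟩
      refine ν.append_mem _ hd z.1 z.2 (hc.lt_of_ne fun h' => ?_)
      simp [← h'] at hpos

theorem partialValue_succ {A E : Type*} [Fintype A] [Fintype E] (γ : ℕ → ℝ) (r : E → ℝ)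
    (ν : Environment A E) (π : Strategy A E) (h : List (A × E)) (hh : h ∈ ν.dom) (n : ℕ) :
    partialValue γ r ν π h (n + 1) = partialValue γ r ν π h n +
      γ (h.length + n) * ∑ w : Fin (n + 1) → A × E, r (w (Fin.last n)).2 * contProb ν π h w := by
  have key : ∀ w : Fin n → A × E,
      ∑ z : A × E, contProb ν π h (Fin.snoc (α := fun _ => A × E) w z) = contProb ν π h w := by
    intro w
    simp_rw [contProb_snoc, ← Finset.mul_sum]
    obtain ⟨h0, h1⟩ := contProb_nonneg_and_mem ν π h hh w
    rcases h0.eq_or_lt with h0 | h0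
    · simp [← h0]
    · rw [Fintype.sum_prod_type]
      simp [← Finset.mul_sum, ν.cond_sum _ (h1 h0), π.prob_sum]
  have e : ∀ f : (Fin (n + 1) → A × E) → ℝ, ∑ w, f w =
      ∑ w : Fin n → A × E, ∑ z : A × E, f (Fin.snoc (α := fun _ => A × E) w z) := by
    intro f
    rw [← (Fin.snocEquiv fun _ : Fin (n + 1) => A × E).sum_comp, Fintype.sum_prod_type_right]
    rfl
  unfold partialValue
  rw [e, e, Finset.mul_sum, ← Finset.sum_add_distrib]
  refine Finset.sum_congr rfl fun w _ => ?_
  rw [← key w, Finset.mul_sum, Finset.mul_sum, ← Finset.sum_add_distrib]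
  refine Finset.sum_congr rfl fun z _ => ?_
  rw [Fin.sum_univ_castSucc]
  simp only [Fin.snoc_castSucc, Fin.snoc_last, Fin.val_castSucc, Fin.val_last]
  ring

theorem sum_contProb {A E : Type*} [Fintype A] [Fintype E]
    (ν : Environment A E) (π : Strategy A E) (h : List (A × E)) (hh : h ∈ ν.dom) (n : ℕ) :
    ∑ w : Fin n → A × E, contProb ν π h w = 1 := by
  induction n with
  | zero => simp [contProb]
  | succ n ih =>
    rw [← ih, ← (Fin.snocEquiv fun _ : Fin (n + 1) => A × E).sum_comp,
      Fintype.sum_prod_type_right]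
    refine Finset.sum_congr rfl fun w _ => ?_
    change ∑ z : A × E, contProb ν π h (Fin.snoc (α := fun _ => A × E) w z) = contProb ν π h w
    simp_rw [contProb_snoc, ← Finset.mul_sum]
    obtain ⟨h0, h1⟩ := contProb_nonneg_and_mem ν π h hh w
    rcases h0.eq_or_lt with h0 | h0
    · simp [← h0]
    · rw [Fintype.sum_prod_type]
      simp [← Finset.mul_sum, ν.cond_sum _ (h1 h0), π.prob_sum]

/-- At the histories at which `ν` is specified, the limit that defines the value exists. -/
theorem tendsto_partialValue {A E : Type*} [Fintype A] [Fintype E] (γ : ℕ → ℝ)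
    (hγ : ∀ t, 0 ≤ γ t) (hγ_sum : Summable γ) (r : E → ℝ) (hr : ∀ e, 0 ≤ r e ∧ r e ≤ 1)
    (ν : Environment A E) (π : Strategy A E) (h : List (A × E)) (hh : h ∈ ν.dom) :
    Filter.Tendsto (partialValue γ r ν π h) Filter.atTop
      (nhds (Filter.limUnder Filter.atTop (partialValue γ r ν π h))) := by
  have hs : Summable fun i => γ (h.length + i) := by
    simpa [add_comm] using (summable_nat_add_iff h.length).2 hγ_sum
  have hb : ∀ n, 0 ≤ ∑ w : Fin (n + 1) → A × E, r (w (Fin.last n)).2 * contProb ν π h w ∧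
      ∑ w : Fin (n + 1) → A × E, r (w (Fin.last n)).2 * contProb ν π h w ≤ 1 := by
    intro n
    refine ⟨Finset.sum_nonneg fun w _ => mul_nonneg (hr _).1
      (contProb_nonneg_and_mem ν π h hh w).1, ?_⟩
    rw [← sum_contProb ν π h hh (n + 1)]
    exact Finset.sum_le_sum fun w _ => mul_le_of_le_one_left
      (contProb_nonneg_and_mem ν π h hh w).1 (hr _).2
  refine tendsto_nhds_limUnder ⟨_, tendsto_atTop_ciSup (monotone_nat_of_le_succ fun n => ?_)
    ⟨∑' i, γ (h.length + i), ?_⟩⟩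
  · rw [partialValue_succ γ r ν π h hh]
    exact le_add_of_nonneg_right (mul_nonneg (hγ _) (hb n).1)
  · rintro _ ⟨n, rfl⟩
    refine le_trans ?_ (hs.sum_le_tsum (Finset.range n) fun i _ => hγ _)
    induction n with
    | zero => simp [partialValue]
    | succ n ih =>
      change partialValue γ r ν π h (n + 1) ≤ _
      rw [partialValue_succ γ r ν π h hh, Finset.sum_range_succ]
      exact add_le_add ih (mul_le_of_le_one_right (hγ _) (hb n).2)

/-! Let `Q h a` be the optimal value of the action `a` at `h` (in the code, `actionValue` of
`optimalValue`), with discounted rewards summed but not normalized. Playing only maximizers of `Q h`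
is optimal: by backward induction such a strategy loses at most the tail `Γ` of the discount over
any finite horizon, and the tail tends to zero (`Strategy.isOptimal_of_greedy`).

It remains to sample such actions. The finite-horizon values can be computed to any precision with
access to `O`, and the tail bounds their distance from `Q`. So if `Q h a ≠ Q h b`, raising horizon
and precision together eventually reveals the better action (`exists_comparison`). On a tie this
search need not halt, and no halting test is available; this is where reflectivity enters. Ask the
oracle whether the comparison machine outputs `a` with probability more than `1/2`. If `a` is
strictly better, the machine outputs `a` almost surely and the answer is `1`; if `b` is strictly
better, the answer is `0`; on a tie either answer is acceptable. A query is always answered, even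
when the machine it asks about diverges. A knockout tournament of such queries therefore halts
almost surely on every input, and at histories in `ν.dom` its winner maximizes `Q h`
(`oracleSolvable_maximal`). Its output distribution is the strategy.

Two points complicate the computation. First, the estimator of the conditionals is randomized, so
repeated runs need not agree. Programs are therefore handled as relations: `OracleSolvable O D R`
asks for almost sure halting with some output in `R x`, for every `x` in `D`, and is closed under
composition, branching, queries and self-reference. Second, the estimator is reliable only on
`ν.dom`, which a continuation of probability zero may leave. A continuation is thus explored only
after the estimate has certified that its probability is positive; otherwise its small contribution
is replaced by `0`. All numerical work is done with natural numbers in units of `1 / (k + 1)`. -/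

/-! ## Machines given by partial recursive step functions -/

section Machines

variable {A E : Type*} [Primcodable A] [Primcodable E]

/-- The next action of a machine, as a partial value. -/
def PTM.step (A E : Type*) [Primcodable A] [Primcodable E] (T : PTM) (i : ℕ) (bits : List Bool) :
    Part (MachineAction A E) :=
  (T.eval (Encodable.encode (i, bits))).bind fun m =>
    ((Encodable.decode m : Option (MachineAction A E)) : Part (MachineAction A E))

theorem PTM.next_eq_some {T : PTM} {i : ℕ} {bits : List Bool} {a : MachineAction A E} :
    PTM.next A E T i bits = some a ↔ a ∈ PTM.step A E T i bits := by
  classical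
  simp only [PTM.next, PTM.step, Option.bind_eq_some_iff, Part.mem_bind_iff, Part.mem_coe]
  refine exists_congr fun m => ?_
  rw [Part.toOption_eq_some_iff]
  exact Iff.rfl

theorem PTM.next_congr {T T' : PTM} {i i' : ℕ} {bits bits' : List Bool}
    (h : PTM.step A E T i bits = PTM.step A E T' i' bits') :
    PTM.next A E T i bits = PTM.next A E T' i' bits' := by
  ext a
  rw [PTM.next_eq_some, PTM.next_eq_some, h]

theorem partrec_step : Partrec fun p : PTM × ℕ × List Bool => PTM.step A E p.1 p.2.1 p.2.2 :=
  (Nat.Partrec.Code.eval_part.comp Computable.fst (Computable.encode.comp Computable.snd)).bind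
    ((Computable.ofOption (Computable.decode.comp Computable.snd)).to₂)

/-- Since the control of a machine is an arbitrary partial recursive program, it suffices to exhibit
a partial recursive step function; later machines are all built from this or from the recursion
theorem. -/
theorem exists_ptm {α : Type*} [Primcodable α] {f : α → List Bool → Part (MachineAction A E)}
    (hf : Partrec₂ f) :
    ∃ T : PTM, ∀ x bits, PTM.step A E T (Encodable.encode x) bits = f x bits := by
  obtain ⟨T, hT⟩ := Nat.Partrec.Code.exists_code.1 hf
  refine ⟨T, fun x bits => ?_⟩
  have : T.eval (Encodable.encode (Encodable.encode x, bits)) =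
      (f x bits).map Encodable.encode := by
    rw [hT]
    have : Encodable.encode (Encodable.encode x, bits) = Encodable.encode (x, bits) := rfl
    rw [this]
    simp
  rw [PTM.step, this, Part.bind_map]
  simp

theorem exists_ptm_of_computable {α : Type*} [Primcodable α] {f : α → List Bool → MachineAction A E}
    (hf : Computable₂ f) :
    ∃ T : PTM, ∀ x bits, PTM.step A E T (Encodable.encode x) bits = Part.some (f x bits) :=
  exists_ptm (f := fun x bits => Part.some (f x bits)) hf.partrec₂

/-! ## Halting probabilities after some bits have been received -/

/-- The probability that `T`, having received `bits`, halts with an output in `S`. -/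
noncomputable def haltProbFrom (O : Oracle A E) (T : PTM) (i : ℕ) (S : Set ℕ)
    (bits : List Bool) : ℝ :=
  ⨆ n, haltProbIn O T i S n bits

variable {O : Oracle A E}

theorem tendsto_haltProbFrom (T : PTM) (i : ℕ) (S : Set ℕ) (bits : List Bool) :
    Filter.Tendsto (fun n => haltProbIn O T i S n bits) Filter.atTop
      (nhds (haltProbFrom O T i S bits)) :=
  tendsto_atTop_ciSup (monotone_nat_of_le_succ fun n => haltProbIn_le_succ O T i S n bits)
    ⟨1, by rintro _ ⟨n, rfl⟩; exact (haltProbIn_mem O T i S n bits).2⟩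

theorem haltProbIn_le_haltProbFrom (T : PTM) (i : ℕ) (S : Set ℕ) (n : ℕ) (bits : List Bool) :
    haltProbIn O T i S n bits ≤ haltProbFrom O T i S bits :=
  le_ciSup (f := fun n => haltProbIn O T i S n bits)
    ⟨1, by rintro _ ⟨n, rfl⟩; exact (haltProbIn_mem O T i S n bits).2⟩ n

theorem haltProbFrom_le_one (T : PTM) (i : ℕ) (S : Set ℕ) (bits : List Bool) :
    haltProbFrom O T i S bits ≤ 1 :=
  ciSup_le fun n => (haltProbIn_mem O T i S n bits).2

theorem haltProbFrom_nonneg (T : PTM) (i : ℕ) (S : Set ℕ) (bits : List Bool) :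
    0 ≤ haltProbFrom O T i S bits :=
  (haltProbIn_mem O T i S 0 bits).1.trans (haltProbIn_le_haltProbFrom T i S 0 bits)

theorem haltProbFrom_query {T : PTM} {i : ℕ} {S : Set ℕ} {bits : List Bool} {q : Query A E}
    (h : Sum.inl q ∈ PTM.step A E T i bits) :
    haltProbFrom O T i S bits = O.answerProb q * haltProbFrom O T i S (true :: bits)
      + (1 - O.answerProb q) * haltProbFrom O T i S (false :: bits) := by
  refine tendsto_nhds_unique
    ((Filter.tendsto_add_atTop_iff_nat 1).2 (tendsto_haltProbFrom T i S bits)) ?_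
  have h' := PTM.next_eq_some.2 h
  simp only [haltProbIn, h']
  exact ((tendsto_haltProbFrom T i S _).const_mul _).add
    ((tendsto_haltProbFrom T i S _).const_mul _)

theorem haltProbFrom_coin {T : PTM} {i : ℕ} {S : Set ℕ} {bits : List Bool} {u : Unit}
    (h : Sum.inr (Sum.inr u) ∈ PTM.step A E T i bits) :
    haltProbFrom O T i S bits = 1 / 2 * haltProbFrom O T i S (true :: bits)
      + 1 / 2 * haltProbFrom O T i S (false :: bits) := by
  refine tendsto_nhds_unique
    ((Filter.tendsto_add_atTop_iff_nat 1).2 (tendsto_haltProbFrom T i S bits)) ?_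
  have h' := PTM.next_eq_some.2 h
  simp only [haltProbIn, h']
  exact ((tendsto_haltProbFrom T i S _).const_mul _).add
    ((tendsto_haltProbFrom T i S _).const_mul _)

theorem haltProbFrom_halt {T : PTM} {i : ℕ} {S : Set ℕ} {bits : List Bool} {m : ℕ}
    (h : Sum.inr (Sum.inl m) ∈ PTM.step A E T i bits) (hm : m ∈ S) :
    haltProbFrom O T i S bits = 1 := by
  refine le_antisymm (haltProbFrom_le_one T i S bits) ?_
  have h' := PTM.next_eq_some.2 h
  refine le_trans ?_ (haltProbIn_le_haltProbFrom T i S 1 bits)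
  simp [haltProbIn, h', hm]

/-- The halting probability depends only on the actions taken after future bits `d`, so two machines
with different pasts `c`, `c'` may be exchanged once their futures agree. This is how control passes
from one machine to the next. -/
theorem haltProbIn_congr {T T' : PTM} {i i' : ℕ} {c c' : List Bool} (S : Set ℕ)
    (h : ∀ d, PTM.step A E T i (d ++ c) = PTM.step A E T' i' (d ++ c')) (n : ℕ) :
    ∀ d, haltProbIn O T i S n (d ++ c) = haltProbIn O T' i' S n (d ++ c') := by
  induction n with
  | zero => intro d; simp [haltProbIn]
  | succ n ih =>
    intro d
    have ht := ih (true :: d)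
    have hf := ih (false :: d)
    simp only [List.cons_append] at ht hf
    rw [haltProbIn, haltProbIn, PTM.next_congr (h d), ht, hf]

theorem haltProbFrom_congr {T T' : PTM} {i i' : ℕ} {c c' : List Bool} (S : Set ℕ)
    (h : ∀ d, PTM.step A E T i (d ++ c) = PTM.step A E T' i' (d ++ c')) :
    haltProbFrom O T i S c = haltProbFrom O T' i' S c' :=
  iSup_congr fun n => haltProbIn_congr S h n []

theorem haltProb_congr {T T' : PTM} {i i' : ℕ} (S : Set ℕ)
    (h : ∀ d, PTM.step A E T i d = PTM.step A E T' i' d) :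
    haltProb O T i S = haltProb O T' i' S :=
  haltProbFrom_congr (c := []) (c' := []) S fun d => by simpa using h d

theorem haltProbIn_mono (T : PTM) (i : ℕ) {S S' : Set ℕ} (h : S ⊆ S') (n : ℕ) (bits : List Bool) :
    haltProbIn O T i S n bits ≤ haltProbIn O T i S' n bits := by
  induction n generalizing bits with
  | zero => simp [haltProbIn]
  | succ n ih =>
    have h1 := ih (true :: bits)
    have h0 := ih (false :: bits)
    rw [haltProbIn, haltProbIn]
    split
    · exact le_rfl
    · rename_i q _
      have hq := O.answerProb_mem q
      nlinarith
    · exact Set.indicator_le_indicator_of_subset h (fun _ => zero_le_one) _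
    · linarith

theorem haltProb_mono (T : PTM) (i : ℕ) {S S' : Set ℕ} (h : S ⊆ S') :
    haltProb O T i S ≤ haltProb O T i S' :=
  le_of_tendsto_of_tendsto' (tendsto_haltProbIn O T i S) (tendsto_haltProbIn O T i S')
    fun n => haltProbIn_mono T i h n []

theorem haltProbIn_sum {ι : Type*} (s : Finset ι) (T : PTM) (i : ℕ) (S : ι → Set ℕ)
    (hS : (s : Set ι).PairwiseDisjoint S) (n : ℕ) (bits : List Bool) :
    haltProbIn O T i (⋃ j ∈ s, S j) n bits = ∑ j ∈ s, haltProbIn O T i (S j) n bits := by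
  classical
  induction n generalizing bits with
  | zero => simp [haltProbIn]
  | succ n ih =>
    simp only [haltProbIn]
    split
    · simp
    · rw [ih, ih, Finset.sum_add_distrib, Finset.mul_sum, Finset.mul_sum]
    · exact Finset.indicator_biUnion_apply s S hS _
    · rw [ih, ih, Finset.sum_add_distrib, Finset.mul_sum, Finset.mul_sum]

theorem haltProb_sum {ι : Type*} (s : Finset ι) (T : PTM) (i : ℕ) (S : ι → Set ℕ)
    (hS : (s : Set ι).PairwiseDisjoint S) :
    haltProb O T i (⋃ j ∈ s, S j) = ∑ j ∈ s, haltProb O T i (S j) := by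
  refine tendsto_nhds_unique (tendsto_haltProbIn O T i _) ?_
  simp only [haltProbIn_sum s T i S hS]
  exact tendsto_finsetSum _ fun j _ => tendsto_haltProbIn O T i (S j)

theorem haltProb_nonneg (T : PTM) (i : ℕ) (S : Set ℕ) : 0 ≤ haltProb O T i S :=
  haltProbFrom_nonneg T i S []

end Machines

/-! ## Sequential composition of machines -/

section Bind

variable {A E : Type*} [Primcodable A] [Primcodable E]

/-- Split off halting actions; `k` is the number of bits received before. -/
def haltInfo (k : ℕ) (a : MachineAction A E) : MachineAction A E ⊕ (ℕ × ℕ) :=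
  Sum.casesOn a (fun q => Sum.inl (Sum.inl q)) fun b =>
    Sum.casesOn b (fun m => Sum.inr (m, k)) fun u => Sum.inl (Sum.inr (Sum.inr u))

/-- The run of `T` on the given bits: its pending action, or its output together with the number
of bits that it used. -/
def PTM.run (A E : Type*) [Primcodable A] [Primcodable E] (T : PTM) (i : ℕ) :
    List Bool → Part (MachineAction A E ⊕ (ℕ × ℕ))
  | [] => (PTM.step A E T i []).map (haltInfo 0)
  | b :: bs => (PTM.run A E T i bs).bind fun s =>
      Sum.casesOn s (fun _ => (PTM.step A E T i (b :: bs)).map (haltInfo (bs.length + 1)))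
        fun r => Part.some (Sum.inr r)

theorem computable_haltInfo : Computable₂ (haltInfo (A := A) (E := E)) := by
  unfold haltInfo
  refine (Primrec.sumCasesOn Primrec.snd ?_ ?_).to_comp
  · exact Primrec.sumInl.comp (Primrec.sumInl.comp Primrec.snd)
  · refine Primrec.sumCasesOn Primrec.snd ?_ ?_
    · exact Primrec.sumInr.comp (Primrec.snd.pair
        (Primrec.fst.comp (Primrec.fst.comp Primrec.fst)))
    · exact Primrec.sumInl.comp (Primrec.sumInr.comp (Primrec.sumInr.comp Primrec.snd))

/-- `PTM.run` by recursion on the number of bits taken into account. -/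
def PTM.runTake (A E : Type*) [Primcodable A] [Primcodable E] (T : PTM) (i : ℕ)
    (bits : List Bool) (n : ℕ) : Part (MachineAction A E ⊕ (ℕ × ℕ)) :=
  n.rec ((PTM.step A E T i []).map (haltInfo 0)) fun n ih => ih.bind fun s =>
    Sum.casesOn s (fun _ => (PTM.step A E T i (bits.drop (bits.length - (n + 1)))).map
      (haltInfo (n + 1))) fun r => Part.some (Sum.inr r)

theorem PTM.runTake_eq (T : PTM) (i : ℕ) (bits : List Bool) (n : ℕ) (hn : n ≤ bits.length) :
    PTM.runTake A E T i bits n = PTM.run A E T i (bits.drop (bits.length - n)) := by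
  induction n with
  | zero => simp [PTM.runTake, PTM.run]
  | succ n ih =>
    have hlt : bits.length - (n + 1) < bits.length := by omega
    have hd := List.drop_eq_getElem_cons hlt
    have h1 : bits.length - (n + 1) + 1 = bits.length - n := by omega
    rw [h1] at hd
    have hl : (bits.drop (bits.length - n)).length = n := by simp; omega
    rw [hd, PTM.run, hl, ← ih (by omega), ← hd]
    rfl

theorem partrec_run (T : PTM) :
    Partrec fun p : ℕ × List Bool => PTM.run A E T p.1 p.2 := by
  have hstep : Partrec fun p : ℕ × List Bool => PTM.step A E T p.1 p.2 :=
    partrec_step.comp ((Computable.const T).pair Computable.id)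
  have : Partrec fun p : ℕ × List Bool => PTM.runTake A E T p.1 p.2 p.2.length := by
    refine Partrec.nat_rec (h := fun (p : ℕ × List Bool) (z : ℕ × (MachineAction A E ⊕ (ℕ × ℕ))) =>
      Sum.casesOn z.2 (fun _ => (PTM.step A E T p.1 (p.2.drop (p.2.length - (z.1 + 1)))).map
        (haltInfo (z.1 + 1))) fun r => Part.some (Sum.inr r))
      (Computable.list_length.comp Computable.snd) ?_ ?_
    · exact (hstep.comp (Computable.fst.pair (Computable.const []))).map
        (computable_haltInfo.comp (Computable.const 0) Computable.snd).to₂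
    · refine Partrec.sumCasesOn_left (Computable.snd.comp Computable.snd) ?_ ?_
      · have hn : Computable fun q : ((ℕ × List Bool) × (ℕ × (MachineAction A E ⊕ (ℕ × ℕ)))) ×
            MachineAction A E => q.1.2.1 + 1 :=
          Computable.succ.comp (Computable.fst.comp (Computable.snd.comp Computable.fst))
        have hb : Computable fun q : ((ℕ × List Bool) × (ℕ × (MachineAction A E ⊕ (ℕ × ℕ)))) ×
            MachineAction A E => q.1.1.2 :=
          Computable.snd.comp (Computable.fst.comp Computable.fst)
        refine (hstep.comp ((Computable.fst.comp (Computable.fst.comp Computable.fst)).pair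
          (Primrec.list_drop.to_comp.comp (Primrec.nat_sub.to_comp.comp
            (Computable.list_length.comp hb) hn) hb))).map ?_
        exact computable_haltInfo.comp (hn.comp Computable.fst) Computable.snd
      · exact (Computable.sumInr.comp Computable.snd).to₂
  refine this.of_eq fun p => ?_
  rw [PTM.runTake_eq _ _ _ _ le_rfl]
  simp

variable {O : Oracle A E}

/-- Running `T` and then `T'` on the pair of the input and the output of `T`. -/
theorem exists_bind_ptm (T T' : PTM) :
    ∃ U : PTM, ∀ i bits, PTM.step A E U i bits =
      (PTM.run A E T i bits).bind fun s => Sum.casesOn s (fun a => Part.some a) fun r =>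
        PTM.step A E T' (Nat.pair i r.1) (bits.take (bits.length - r.2)) := by
  -- Bits are listed newest first. Keeping the first `bits.length - r.2` of them drops the oldest
  -- `r.2`, which `T` has consumed, so `T'` starts with an empty past.
  refine exists_ptm (α := ℕ) (f := fun i bits => (PTM.run A E T i bits).bind fun s =>
    Sum.casesOn s (fun a => Part.some a) fun r =>
      PTM.step A E T' (Nat.pair i r.1) (bits.take (bits.length - r.2))) ?_
  refine Partrec.bind (partrec_run T) ?_
  refine Partrec.sumCasesOn_right Computable.snd Computable.snd.to₂ ?_
  have hr : Computable fun q : ((ℕ × List Bool) × (MachineAction A E ⊕ (ℕ × ℕ))) × (ℕ × ℕ) =>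
    q.2 := Computable.snd
  have hb : Computable fun q : ((ℕ × List Bool) × (MachineAction A E ⊕ (ℕ × ℕ))) × (ℕ × ℕ) =>
    q.1.1.2 := Computable.snd.comp (Computable.fst.comp Computable.fst)
  exact partrec_step.comp ((Computable.const T').pair
    ((Primrec₂.natPair.to_comp.comp (Computable.fst.comp (Computable.fst.comp Computable.fst))
      (Computable.fst.comp hr)).pair
    (Primrec.list_take.to_comp.comp (Primrec.nat_sub.to_comp.comp (Computable.list_length.comp hb)
      (Computable.snd.comp hr)) hb)))

theorem PTM.run_append {T : PTM} {i : ℕ} {c : List Bool} {r : ℕ × ℕ}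
    (h : PTM.run A E T i c = Part.some (Sum.inr r)) (d : List Bool) :
    PTM.run A E T i (d ++ c) = Part.some (Sum.inr r) := by
  induction d with
  | nil => exact h
  | cons b d ih => simp [PTM.run, ih]

/-- As long as `T` is running, `U` copies its actions; once `T` halts in `S`, the rest of the run is
that of `T'`, which succeeds almost surely. The hypothesis `hc` says that `T` has not halted on an
earlier part of `c`. An inequality is enough, because it is applied when the left side tends to `1`.
-/
theorem haltProbIn_le_bind {T T' U : PTM} {i : ℕ}
    (hU : ∀ bits, PTM.step A E U i bits =
      (PTM.run A E T i bits).bind fun s => Sum.casesOn s (fun a => Part.some a) fun r =>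
        PTM.step A E T' (Nat.pair i r.1) (bits.take (bits.length - r.2)))
    {S S' : Set ℕ} (hS : ∀ m ∈ S, haltProb O T' (Nat.pair i m) S' = 1) (n : ℕ) (c : List Bool)
    (hc : PTM.run A E T i c = (PTM.step A E T i c).map (haltInfo c.length)) :
    haltProbIn O T i S n c ≤ haltProbFrom O U i S' c := by
  induction n generalizing c with
  | zero => exact haltProbFrom_nonneg U i S' c
  | succ n ih =>
    have hnext : ∀ a, PTM.step A E T i c = Part.some a → haltInfo c.length a = Sum.inl a →
        ∀ b : Bool, PTM.run A E T i (b :: c) =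
          (PTM.step A E T i (b :: c)).map (haltInfo (b :: c).length) := by
      intro a h ha b
      rw [PTM.run, hc, h]
      simp [ha]
    rw [haltProbIn]
    split
    · exact haltProbFrom_nonneg U i S' c
    · rename_i q hq
      have h := Part.eq_some_iff.2 (PTM.next_eq_some.1 hq)
      have h' := hnext _ h rfl
      have hs : Sum.inl q ∈ PTM.step A E U i c := by
        rw [hU, hc, h]
        simp [haltInfo]
      rw [haltProbFrom_query hs]
      have hq := O.answerProb_mem q
      exact add_le_add (mul_le_mul_of_nonneg_left (ih _ (h' _)) hq.1)
        (mul_le_mul_of_nonneg_left (ih _ (h' _)) (by linarith))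
    · rename_i m hm
      have h := Part.eq_some_iff.2 (PTM.next_eq_some.1 hm)
      by_cases hmS : m ∈ S
      · have hrun : PTM.run A E T i c = Part.some (Sum.inr (m, c.length)) := by
          rw [hc, h]
          simp [haltInfo]
        have : haltProbFrom O U i S' c = haltProb O T' (Nat.pair i m) S' := by
          refine haltProbFrom_congr (c' := []) S' fun d => ?_
          rw [hU, PTM.run_append hrun]
          simp
        rw [this, hS m hmS]
        simp [hmS]
      · simpa [hmS] using haltProbFrom_nonneg U i S' c
    · rename_i u hu
      have h := Part.eq_some_iff.2 (PTM.next_eq_some.1 hu)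
      have hs : Sum.inr (Sum.inr u) ∈ PTM.step A E U i c := by
        rw [hU, hc, h]
        simp [haltInfo]
      rw [haltProbFrom_coin hs]
      have h' := hnext _ h rfl
      exact add_le_add (mul_le_mul_of_nonneg_left (ih _ (h' _)) (by norm_num))
        (mul_le_mul_of_nonneg_left (ih _ (h' _)) (by norm_num))

end Bind

/-! ## Relations solvable with probability one -/

section Solvable

variable {A E : Type*} [Primcodable A] [Primcodable E]
variable {α β δ : Type*} [Primcodable α] [Primcodable β] [Primcodable δ]

/-- The machine `T` on input `x` halts with probability one with an output in `R`. -/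
def PTM.Solves (O : Oracle A E) (T : PTM) (x : α) (R : Set β) : Prop :=
  haltProb O T (Encodable.encode x) (Encodable.encode '' R) = 1

/-- Some machine on every input `x` in `D` halts with probability one with an output in `R x`. -/
def OracleSolvable (O : Oracle A E) (D : Set α) (R : α → Set β) : Prop :=
  ∃ T : PTM, ∀ x ∈ D, T.Solves O x (R x)

variable {O : Oracle A E} {D : Set α} {R : α → Set β}

theorem PTM.Solves.mono {T : PTM} {x : α} {R R' : Set β} (h : T.Solves O x R) (hR : R ⊆ R') :
    T.Solves O x R' :=
  le_antisymm (haltProbFrom_le_one T _ _ [])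
    (h.symm.le.trans (haltProb_mono T _ (Set.image_mono hR)))

theorem PTM.solves_congr {T T' : PTM} {x : α} {y : β} {S : Set δ}
    (h : ∀ d, PTM.step A E T (Encodable.encode x) d = PTM.step A E T' (Encodable.encode y) d) :
    T.Solves O x S ↔ T'.Solves O y S := by
  rw [PTM.Solves, PTM.Solves, haltProb_congr _ h]

theorem OracleSolvable.mono {D' : Set α} {R' : α → Set β} (h : OracleSolvable O D R)
    (hD : D' ⊆ D) (hR : ∀ x ∈ D', R x ⊆ R' x) : OracleSolvable O D' R' :=
  let ⟨T, hT⟩ := h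
  ⟨T, fun x hx => (hT x (hD hx)).mono (hR x hx)⟩

/-- Running a machine that is computed from the input. -/
theorem OracleSolvable.call {s : α → PTM} (hs : Computable s) {f : α → δ} (hf : Computable f)
    (h : ∀ x ∈ D, (s x).Solves O (f x) (R x)) : OracleSolvable O D R := by
  obtain ⟨T, hT⟩ := exists_ptm (A := A) (E := E)
    (f := fun (x : α) bits => PTM.step A E (s x) (Encodable.encode (f x)) bits)
    (partrec_step.comp ((hs.comp Computable.fst).pair
      ((Computable.encode.comp (hf.comp Computable.fst)).pair Computable.snd)))
  exact ⟨T, fun x hx => (PTM.solves_congr (hT x)).2 (h x hx)⟩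

theorem OracleSolvable.comp {D' : Set δ} {R' : δ → Set β} (h : OracleSolvable O D' R')
    {f : α → δ} (hf : Computable f) (hD : ∀ x ∈ D, f x ∈ D') :
    OracleSolvable O D fun x => R' (f x) :=
  let ⟨T, hT⟩ := h
  .call (Computable.const T) hf fun x hx => hT (f x) (hD x hx)

theorem PTM.solves_of_halt {T : PTM} {x : α} {y : β} {S : Set β} (hy : y ∈ S)
    (h : Sum.inr (Sum.inl (Encodable.encode y)) ∈ PTM.step A E T (Encodable.encode x) []) :
    T.Solves O x S :=
  haltProbFrom_halt h (Set.mem_image_of_mem _ hy)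

theorem OracleSolvable.pure {f : α → β} (hf : Computable f) (h : ∀ x ∈ D, f x ∈ R x) :
    OracleSolvable O D R := by
  obtain ⟨T, hT⟩ := exists_ptm_of_computable (A := A) (E := E)
    (f := fun (x : α) (_ : List Bool) => Sum.inr (Sum.inl (Encodable.encode (f x))))
    (Computable.sumInr.comp (Computable.sumInl.comp (Computable.encode.comp
      (hf.comp Computable.fst))))
  refine ⟨T, fun x hx => PTM.solves_of_halt (h x hx) ?_⟩
  rw [hT]
  exact Part.mem_some _

/-- The first output is random, so the second machine has to work for every admissible `y`, not for
one chosen value. -/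
theorem OracleSolvable.bind {D' : Set (α × β)} {R' : α × β → Set δ} {R'' : α → Set δ}
    (h : OracleSolvable O D R) (h' : OracleSolvable O D' R')
    (hD : ∀ x ∈ D, ∀ y ∈ R x, (x, y) ∈ D' ∧ R' (x, y) ⊆ R'' x) : OracleSolvable O D R'' := by
  obtain ⟨T, hT⟩ := h
  obtain ⟨T', hT'⟩ := h'
  obtain ⟨U, hU⟩ := exists_bind_ptm (A := A) (E := E) T T'
  refine ⟨U, fun x hx => le_antisymm (haltProbFrom_le_one U _ _ []) ?_⟩
  rw [← hT x hx]
  refine ciSup_le fun n => haltProbIn_le_bind (T' := T') (hU (Encodable.encode x)) ?_ n [] ?_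
  · rintro _ ⟨y, hy, rfl⟩
    exact (hT' (x, y) (hD x hx y hy).1).mono (hD x hx y hy).2
  · rfl

theorem OracleSolvable.map {f : α × β → δ} {R' : α → Set δ} (h : OracleSolvable O D R)
    (hf : Computable f) (hR : ∀ x ∈ D, ∀ y ∈ R x, f (x, y) ∈ R' x) : OracleSolvable O D R' :=
  h.bind (D' := {z | z.1 ∈ D ∧ z.2 ∈ R z.1}) (R' := fun z => R' z.1)
    (.pure hf fun z hz => hR z.1 hz.1 z.2 hz.2) fun _ hx _ hy => ⟨⟨hx, hy⟩, subset_rfl⟩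

theorem OracleSolvable.prod {R' : α → Set δ} (h : OracleSolvable O D R)
    (h' : OracleSolvable O D R') : OracleSolvable O D fun x => R x ×ˢ R' x :=
  h.bind (D' := {z | z.1 ∈ D ∧ z.2 ∈ R z.1}) (R' := fun z => R z.1 ×ˢ R' z.1)
    ((h'.comp Computable.fst fun _ hz => hz.1).map (f := fun q => (q.1.2, q.2))
      ((Computable.snd.comp Computable.fst).pair Computable.snd) fun _ hz _ hy => ⟨hz.2, hy⟩)
    fun _ hx _ hy => ⟨⟨hx, hy⟩, subset_rfl⟩

/-- The test selects the code that is run. The other branch is never started, so it may diverge. -/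
theorem OracleSolvable.cond {c : α → Bool} (hc : Computable c)
    (h₁ : OracleSolvable O {x ∈ D | c x = true} R)
    (h₂ : OracleSolvable O {x ∈ D | c x = false} R) : OracleSolvable O D R := by
  obtain ⟨T₁, h₁⟩ := h₁
  obtain ⟨T₂, h₂⟩ := h₂
  refine .call (s := fun x => bif c x then T₁ else T₂)
    (hc.cond (Computable.const T₁) (Computable.const T₂)) Computable.id fun x hx => ?_
  cases h : c x
  · exact h₂ x ⟨hx, h⟩
  · exact h₁ x ⟨hx, h⟩

/-- Putting a query to the oracle. -/
theorem OracleSolvable.query {q : α → Query A E} (hq : Computable q) :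
    OracleSolvable O Set.univ fun x =>
      {b : Bool | b = true ∧ O.answerProb (q x) ≠ 0 ∨ b = false ∧ O.answerProb (q x) ≠ 1} := by
  -- With no bits received the machine puts the query; the first bit is the answer, and it is
  -- returned at once.
  obtain ⟨T, hT⟩ := exists_ptm_of_computable (A := A) (E := E)
    (f := fun (x : α) (bits : List Bool) => (Option.casesOn bits.head?
      (Sum.inl (q x)) fun b => Sum.inr (Sum.inl (Encodable.encode b)) : MachineAction A E))
    (Computable.option_casesOn (Primrec.list_head?.to_comp.comp Computable.snd)
      (Computable.sumInl.comp (hq.comp Computable.fst))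
      (Computable.sumInr.comp (Computable.sumInl.comp (Computable.encode.comp
        Computable.snd))).to₂)
  refine ⟨T, fun x _ => ?_⟩
  set S := Encodable.encode '' {b : Bool | b = true ∧ O.answerProb (q x) ≠ 0 ∨
    b = false ∧ O.answerProb (q x) ≠ 1} with hS
  have key : ∀ b : Bool, Encodable.encode b ∈ S →
      haltProbFrom O T (Encodable.encode x) S [b] = 1 := fun b hb =>
    haltProbFrom_halt (m := Encodable.encode b) (by rw [hT]; exact Part.mem_some _) hb
  have h0 : haltProb O T (Encodable.encode x) S = _ :=
    haltProbFrom_query (bits := []) (q := q x) (by rw [hT]; exact Part.mem_some _)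
  rw [PTM.Solves, ← hS, h0]
  by_cases ht : O.answerProb (q x) = 0
  · rw [ht, key false ⟨false, by simp [ht], rfl⟩]
    ring
  · by_cases hf : O.answerProb (q x) = 1
    · rw [hf, key true ⟨true, by simp [ht], rfl⟩]
      ring
    · rw [key false ⟨false, by simp [hf], rfl⟩, key true ⟨true, by simp [ht], rfl⟩]
      ring

/-- Kleene's recursion theorem: a machine that may call itself. -/
theorem OracleSolvable.recursion {D : Set (PTM × α)} {R : PTM × α → Set β}
    (h : OracleSolvable O D R) :
    ∃ T : PTM, ∀ x, (T, x) ∈ D → T.Solves O x (R (T, x)) := by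
  obtain ⟨U, hU⟩ := h
  -- The program to be made self-referential: prepend its own code `c` to the input and run `U`.
  have hf : Partrec₂ fun (c : PTM) (m : ℕ) => ((Encodable.decode m : Option (ℕ × List Bool)) :
      Part (ℕ × List Bool)).bind fun p =>
        U.eval (Encodable.encode (Nat.pair (Encodable.encode c) p.1, p.2)) := by
    refine Partrec.bind (Computable.ofOption (Computable.decode.comp Computable.snd)) ?_
    refine Nat.Partrec.Code.eval_part.comp (Computable.const U) (Computable.encode.comp ?_)
    exact (Primrec₂.natPair.to_comp.comp
      (Computable.encode.comp (Computable.fst.comp Computable.fst))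
      (Computable.fst.comp Computable.snd)).pair (Computable.snd.comp Computable.snd)
  obtain ⟨T, hT⟩ := Nat.Partrec.Code.fixed_point₂ hf
  refine ⟨T, fun x hx => (PTM.solves_congr (y := (T, x)) fun d => ?_).2 (hU _ hx)⟩
  rw [PTM.step, hT, PTM.step]
  simp

/-- Running a machine for each member of a fixed list. -/
theorem OracleSolvable.list {ι : Type*} {R : ι → α → Set β} (l : List ι)
    (h : ∀ j ∈ l, OracleSolvable O D (R j)) :
    OracleSolvable O D fun x => {ys : List β | List.Forall₂ (fun j y => y ∈ R j x) l ys} := by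
  induction l with
  | nil => exact .pure (Computable.const []) fun x _ => List.Forall₂.nil
  | cons j l ih =>
    refine (h j (by simp)).bind (D' := {z | z.1 ∈ D ∧ z.2 ∈ R j z.1})
      (R' := fun z => {ys | List.Forall₂ (fun j y => y ∈ R j z.1) (j :: l) ys}) ?_ fun x hx y hy =>
      ⟨⟨hx, hy⟩, subset_rfl⟩
    refine ((ih fun j' hj' => h j' (by simp [hj'])).comp Computable.fst fun z hz => hz.1).map
      (f := fun p => p.1.2 :: p.2) ?_ fun z hz ys hys => List.Forall₂.cons hz.2 hys
    exact Computable.list_cons.comp (Computable.snd.comp Computable.fst) Computable.snd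

end Solvable

/-! ## Finite-horizon values and greedy strategies -/

section Values

variable {A E : Type*} [Fintype E]

/-- The value of the action `a` at `h` if `V` gives the values one round later. -/
noncomputable def actionValue (γ : ℕ → ℝ) (r : E → ℝ) (ν : Environment A E)
    (V : List (A × E) → ℝ) (h : List (A × E)) (a : A) : ℝ :=
  ∑ e, ν.cond h a e * (γ h.length * r e + V (h ++ [(a, e)]))

/-- The maximal expected discounted reward sum over the next `n` rounds. -/
noncomputable def horizonValue (γ : ℕ → ℝ) (r : E → ℝ) (ν : Environment A E) :
    ℕ → List (A × E) → ℝ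
  | 0 => fun _ => 0
  | n + 1 => fun h => ⨆ a, actionValue γ r ν (horizonValue γ r ν n) h a

/-- The maximal expected discounted reward sum. -/
noncomputable def optimalValue (γ : ℕ → ℝ) (r : E → ℝ) (ν : Environment A E)
    (h : List (A × E)) : ℝ :=
  ⨆ n, horizonValue γ r ν n h

theorem discountNorm_nonneg {γ : ℕ → ℝ} (hγ : ∀ t, 0 ≤ γ t) (t : ℕ) : 0 ≤ discountNorm γ t :=
  tsum_nonneg fun _ => hγ _

theorem discountNorm_eq_add {γ : ℕ → ℝ} (hγ : Summable γ) (t : ℕ) :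
    discountNorm γ t = γ t + discountNorm γ (t + 1) := by
  have hs : Summable fun i => γ (t + i) := by
    simpa [add_comm] using (summable_nat_add_iff t).2 hγ
  rw [discountNorm, hs.tsum_eq_zero_add, discountNorm]
  simp [add_assoc, add_comm 1]

theorem tendsto_discountNorm {γ : ℕ → ℝ} :
    Filter.Tendsto (discountNorm γ) Filter.atTop (nhds 0) := by
  have := tendsto_sum_nat_add γ
  simpa only [funext fun t => show discountNorm γ t = ∑' k, γ (k + t) by
    simp only [discountNorm, add_comm]] using this

theorem discountNorm_antitone {γ : ℕ → ℝ} (hγ : ∀ t, 0 ≤ γ t) (hs : Summable γ) :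
    Antitone (discountNorm γ) :=
  antitone_nat_of_succ_le fun t => by linarith [discountNorm_eq_add hs t, hγ t]

variable {γ : ℕ → ℝ} {r : E → ℝ} {ν : Environment A E}

/-- The conditionals sum to one, so a uniform error passes through the expectation unamplified. The
bound is needed only inside `ν.dom`: other continuations have weight zero. -/
theorem actionValue_le_add {V V' : List (A × E) → ℝ} {h : List (A × E)} (hh : h ∈ ν.dom) (a : A)
    {c : ℝ} (hV : ∀ e, h ++ [(a, e)] ∈ ν.dom → V (h ++ [(a, e)]) ≤ V' (h ++ [(a, e)]) + c) :
    actionValue γ r ν V h a ≤ actionValue γ r ν V' h a + c := by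
  have hc : c = ∑ e, ν.cond h a e * c := by rw [← Finset.sum_mul, ν.cond_sum h hh, one_mul]
  rw [hc, actionValue, actionValue, ← Finset.sum_add_distrib]
  refine Finset.sum_le_sum fun e _ => ?_
  rw [← mul_add]
  rcases (ν.cond_nonneg h hh a e).eq_or_lt with h0 | h0
  · simp [← h0]
  · exact mul_le_mul_of_nonneg_left (by linarith [hV e (ν.append_mem h hh a e h0)]) h0.le

theorem actionValue_nonneg (hγ : ∀ t, 0 ≤ γ t) (hr : ∀ e, 0 ≤ r e ∧ r e ≤ 1)
    {V : List (A × E) → ℝ} {h : List (A × E)} (hh : h ∈ ν.dom) (a : A)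
    (hV : ∀ e, h ++ [(a, e)] ∈ ν.dom → 0 ≤ V (h ++ [(a, e)])) : 0 ≤ actionValue γ r ν V h a := by
  refine Finset.sum_nonneg fun e _ => ?_
  rcases (ν.cond_nonneg h hh a e).eq_or_lt with h0 | h0
  · simp [← h0]
  · exact mul_nonneg h0.le
      (add_nonneg (mul_nonneg (hγ _) (hr e).1) (hV e (ν.append_mem h hh a e h0)))

theorem actionValue_le_of_zero (hγ : ∀ t, 0 ≤ γ t) (hr : ∀ e, 0 ≤ r e ∧ r e ≤ 1)
    {h : List (A × E)} (hh : h ∈ ν.dom) (a : A) :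
    actionValue γ r ν (fun _ => 0) h a ≤ γ h.length := by
  have : γ h.length = ∑ e, ν.cond h a e * γ h.length := by
    rw [← Finset.sum_mul, ν.cond_sum h hh, one_mul]
  rw [this, actionValue]
  refine Finset.sum_le_sum fun e _ => mul_le_mul_of_nonneg_left ?_ (ν.cond_nonneg h hh a e)
  rw [add_zero]
  exact mul_le_of_le_one_right (hγ _) (hr e).2

theorem horizonValue_nonneg (hγ : ∀ t, 0 ≤ γ t) (hr : ∀ e, 0 ≤ r e ∧ r e ≤ 1) (n : ℕ)
    {h : List (A × E)} (hh : h ∈ ν.dom) : 0 ≤ horizonValue γ r ν n h := by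
  induction n generalizing h with
  | zero => exact le_rfl
  | succ n ih => exact Real.iSup_nonneg fun a => actionValue_nonneg hγ hr hh a fun e he => ih he

variable [Fintype A]

theorem actionValue_le_horizonValue (n : ℕ) (h : List (A × E)) (a : A) :
    actionValue γ r ν (horizonValue γ r ν n) h a ≤ horizonValue γ r ν (n + 1) h :=
  le_ciSup (f := fun a => actionValue γ r ν (horizonValue γ r ν n) h a)
    (Set.finite_range _).bddAbove a

theorem horizonValue_le_succ [Nonempty A] (hγ : ∀ t, 0 ≤ γ t) (hr : ∀ e, 0 ≤ r e ∧ r e ≤ 1) (n : ℕ)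
    {h : List (A × E)} (hh : h ∈ ν.dom) :
    horizonValue γ r ν n h ≤ horizonValue γ r ν (n + 1) h := by
  induction n generalizing h with
  | zero => exact horizonValue_nonneg hγ hr 1 hh
  | succ n ih =>
    refine ciSup_le fun a => le_trans ?_ (actionValue_le_horizonValue (n + 1) h a)
    simpa using actionValue_le_add (c := 0) hh a fun e he => by simpa using ih he

/-- Rounds beyond the first `n` contribute at most the discount mass left there. Both horizons
shrink by one in the induction step; when `n` runs out, every remaining reward is bounded by `1`. -/
theorem horizonValue_add_le [Nonempty A] (hγ : ∀ t, 0 ≤ γ t) (hs : Summable γ)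
    (hr : ∀ e, 0 ≤ r e ∧ r e ≤ 1) (m n : ℕ) {h : List (A × E)} (hh : h ∈ ν.dom) :
    horizonValue γ r ν m h ≤ horizonValue γ r ν n h + discountNorm γ (h.length + n) := by
  induction m generalizing h n with
  | zero =>
    exact add_nonneg (horizonValue_nonneg hγ hr n hh) (discountNorm_nonneg hγ _)
  | succ m ih =>
    refine ciSup_le fun a => ?_
    cases n with
    | zero =>
      have h1 := actionValue_le_add (γ := γ) (r := r) (V := horizonValue γ r ν m)
        (V' := fun _ => 0) (c := discountNorm γ (h.length + 1)) hh a
        fun e he => by simpa [horizonValue] using ih 0 he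
      have h2 := actionValue_le_of_zero hγ hr hh a
      have h3 := discountNorm_eq_add hs h.length
      simp only [horizonValue, add_zero]
      linarith
    | succ n =>
      have h1 := actionValue_le_add (γ := γ) (r := r) (V := horizonValue γ r ν m)
        (V' := horizonValue γ r ν n) (c := discountNorm γ (h.length + (n + 1))) hh a
        fun e he => by
          have := ih n he
          simpa [add_assoc, add_comm 1] using this
      linarith [actionValue_le_horizonValue (γ := γ) (r := r) (ν := ν) n h a]

theorem bddAbove_horizonValue [Nonempty A] (hγ : ∀ t, 0 ≤ γ t) (hs : Summable γ)
    (hr : ∀ e, 0 ≤ r e ∧ r e ≤ 1) {h : List (A × E)} (hh : h ∈ ν.dom) :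
    BddAbove (Set.range fun n => horizonValue γ r ν n h) :=
  ⟨_, by rintro _ ⟨n, rfl⟩; exact horizonValue_add_le hγ hs hr n 0 hh⟩

theorem horizonValue_le_optimalValue [Nonempty A] (hγ : ∀ t, 0 ≤ γ t) (hs : Summable γ)
    (hr : ∀ e, 0 ≤ r e ∧ r e ≤ 1) (n : ℕ) {h : List (A × E)} (hh : h ∈ ν.dom) :
    horizonValue γ r ν n h ≤ optimalValue γ r ν h :=
  le_ciSup (bddAbove_horizonValue hγ hs hr hh) n

theorem optimalValue_le_horizonValue_add [Nonempty A] (hγ : ∀ t, 0 ≤ γ t) (hs : Summable γ)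
    (hr : ∀ e, 0 ≤ r e ∧ r e ≤ 1) (n : ℕ) {h : List (A × E)} (hh : h ∈ ν.dom) :
    optimalValue γ r ν h ≤ horizonValue γ r ν n h + discountNorm γ (h.length + n) :=
  ciSup_le fun m => horizonValue_add_le hγ hs hr m n hh

theorem actionValue_horizonValue_mem [Nonempty A] (hγ : ∀ t, 0 ≤ γ t) (hs : Summable γ)
    (hr : ∀ e, 0 ≤ r e ∧ r e ≤ 1) (n : ℕ) {h : List (A × E)} (hh : h ∈ ν.dom) (a : A) :
    actionValue γ r ν (horizonValue γ r ν n) h a ≤ actionValue γ r ν (optimalValue γ r ν) h a ∧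
    actionValue γ r ν (optimalValue γ r ν) h a ≤
      actionValue γ r ν (horizonValue γ r ν n) h a + discountNorm γ (h.length + 1 + n) := by
  constructor
  · simpa using actionValue_le_add (c := 0) hh a fun e he => by
      simpa using horizonValue_le_optimalValue hγ hs hr n he
  · refine actionValue_le_add hh a fun e he => ?_
    simpa using optimalValue_le_horizonValue_add hγ hs hr n he

theorem optimalValue_le_of_greedy [Nonempty A] (hγ : ∀ t, 0 ≤ γ t) (hs : Summable γ)
    (hr : ∀ e, 0 ≤ r e ∧ r e ≤ 1) {h : List (A × E)} (hh : h ∈ ν.dom) {a : A}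
    (ha : ∀ b, actionValue γ r ν (optimalValue γ r ν) h b ≤
      actionValue γ r ν (optimalValue γ r ν) h a) :
    optimalValue γ r ν h ≤ actionValue γ r ν (optimalValue γ r ν) h a := by
  refine ciSup_le fun n => (horizonValue_le_succ hγ hr n hh).trans (ciSup_le fun b => ?_)
  exact (actionValue_horizonValue_mem hγ hs hr n hh b).1.trans (ha b)

theorem contProb_cons (π : Strategy A E) (h : List (A × E)) {n : ℕ} (z : A × E)
    (w : Fin n → A × E) :
    contProb ν π h (Fin.cons (α := fun _ => A × E) z w) =
      π.prob h z.1 * ν.cond h z.1 z.2 * contProb ν π (h ++ [z]) w := by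
  have hl : List.ofFn (Fin.cons (α := fun _ => A × E) z w) = z :: List.ofFn w := by
    rw [List.ofFn_succ]
    simp
  unfold contProb
  rw [Fin.prod_univ_succ, hl]
  simp

/-- Bellman's decomposition at the first round. The first reward factors out because the
continuations have total probability one, which is available only after a percept of positive
probability; the other terms vanish on both sides. -/
theorem partialValue_succ_eq_sum (π : Strategy A E) {h : List (A × E)} (hh : h ∈ ν.dom) (n : ℕ) :
    partialValue γ r ν π h (n + 1) =
      ∑ a, π.prob h a * actionValue γ r ν (fun h' => partialValue γ r ν π h' n) h a := by
  have e : ∀ f : (Fin (n + 1) → A × E) → ℝ, ∑ w, f w =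
      ∑ z : A × E, ∑ w : Fin n → A × E, f (Fin.cons (α := fun _ => A × E) z w) := by
    intro f
    rw [← (Fin.consEquiv fun _ : Fin (n + 1) => A × E).sum_comp, Fintype.sum_prod_type]
    rfl
  rw [partialValue, e, Fintype.sum_prod_type]
  refine Finset.sum_congr rfl fun a _ => ?_
  rw [actionValue, Finset.mul_sum]
  refine Finset.sum_congr rfl fun x _ => ?_
  simp only [contProb_cons, Fin.sum_univ_succ, Fin.cons_zero, Fin.cons_succ, Fin.val_zero,
    add_zero, Fin.val_succ]
  rcases (ν.cond_nonneg h hh a x).eq_or_lt with h0 | h0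
  · simp [← h0]
  · have hd := ν.append_mem h hh a x h0
    have h1 := sum_contProb ν π _ hd n
    have hp : partialValue γ r ν π (h ++ [(a, x)]) n = ∑ w : Fin n → A × E,
        (∑ i : Fin n, γ (h.length + (i + 1)) * r (w i).2) *
          contProb ν π (h ++ [(a, x)]) w := by
      simp [partialValue, add_assoc, add_comm 1]
    have hg : γ h.length * r x =
        ∑ w : Fin n → A × E, γ h.length * r x * contProb ν π (h ++ [(a, x)]) w := by
      rw [← Finset.mul_sum, h1, mul_one]
    conv_rhs => rw [hp, hg, ← Finset.sum_add_distrib, Finset.mul_sum, Finset.mul_sum]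
    refine Finset.sum_congr rfl fun w _ => ?_
    ring

theorem partialValue_le_horizonValue (π : Strategy A E) (n : ℕ) {h : List (A × E)}
    (hh : h ∈ ν.dom) : partialValue γ r ν π h n ≤ horizonValue γ r ν n h := by
  induction n generalizing h with
  | zero => simp [partialValue, horizonValue]
  | succ n ih =>
    rw [partialValue_succ_eq_sum π hh, ← one_mul (horizonValue γ r ν (n + 1) h), ← π.prob_sum h,
      Finset.sum_mul]
    refine Finset.sum_le_sum fun a _ => mul_le_mul_of_nonneg_left ?_ (π.prob_nonneg h a)
    refine le_trans ?_ (actionValue_le_horizonValue n h a)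
    simpa using actionValue_le_add (c := 0) hh a fun e he => by simpa using ih he

/-- Each action actually played attains the optimal value at its history, so only the truncation
after `n` rounds is lost. -/
theorem optimalValue_le_partialValue_add [Nonempty A] (hγ : ∀ t, 0 ≤ γ t) (hs : Summable γ)
    (hr : ∀ e, 0 ≤ r e ∧ r e ≤ 1) {π : Strategy A E}
    (hπ : ∀ h ∈ ν.dom, ∀ a, π.prob h a ≠ 0 → ∀ b, actionValue γ r ν (optimalValue γ r ν) h b ≤
      actionValue γ r ν (optimalValue γ r ν) h a) (n : ℕ) {h : List (A × E)} (hh : h ∈ ν.dom) :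
    optimalValue γ r ν h ≤ partialValue γ r ν π h n + discountNorm γ (h.length + n) := by
  induction n generalizing h with
  | zero =>
    simpa [partialValue, horizonValue] using optimalValue_le_horizonValue_add hγ hs hr 0 hh
  | succ n ih =>
    rw [partialValue_succ_eq_sum π hh, ← one_mul (optimalValue γ r ν h), ← π.prob_sum h,
      Finset.sum_mul, ← one_mul (discountNorm γ _), ← π.prob_sum h, Finset.sum_mul,
      ← Finset.sum_add_distrib]
    refine Finset.sum_le_sum fun a _ => ?_
    rw [← mul_add]
    by_cases h0 : π.prob h a = 0
    · simp [h0]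
    · refine mul_le_mul_of_nonneg_left ?_ (π.prob_nonneg h a)
      refine (optimalValue_le_of_greedy hγ hs hr hh (hπ h hh a h0)).trans ?_
      refine actionValue_le_add hh a fun e he => ?_
      have := ih he
      simpa [add_assoc, add_comm 1] using this

/-- A strategy that only plays actions of maximal value is optimal. -/
theorem Strategy.isOptimal_of_greedy [Nonempty A] (hγ : ∀ t, 0 ≤ γ t) (hs : Summable γ)
    (hr : ∀ e, 0 ≤ r e ∧ r e ≤ 1) {π : Strategy A E}
    (hπ : ∀ h ∈ ν.dom, ∀ a, π.prob h a ≠ 0 → ∀ b, actionValue γ r ν (optimalValue γ r ν) h b ≤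
      actionValue γ r ν (optimalValue γ r ν) h a) : π.IsOptimal γ r ν := by
  intro h hh π'
  -- The normalization is a common nonnegative factor; it is `0` when the discount norm vanishes, so
  -- no case distinction is needed.
  refine mul_le_mul_of_nonneg_left ?_ (one_div_nonneg.2 (discountNorm_nonneg hγ _))
  have h1 := tendsto_partialValue γ hγ hs r hr ν π' h hh
  have h2 := (tendsto_partialValue γ hγ hs r hr ν π h hh).add
    ((tendsto_discountNorm (γ := γ)).comp (Filter.tendsto_add_atTop_nat h.length))
  rw [add_zero] at h2
  refine (le_of_tendsto' (b := optimalValue γ r ν h) h1 fun n => ?_).trans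
    (ge_of_tendsto' h2 fun n => ?_)
  · exact (partialValue_le_horizonValue π' n hh).trans
      (horizonValue_le_optimalValue hγ hs hr n hh)
  · simpa [add_comm] using optimalValue_le_partialValue_add hγ hs hr hπ n hh

end Values

/-! ## Fixed-point approximations -/

section FixedPoint

/-- Nonnegative integers have even codes and negative ones odd codes, so the function is a parity
test and a halving. -/
theorem primrec_toNat : Primrec Int.toNat := by
  have h : Primrec fun z : ℤ => if (Encodable.encode z) % 2 = 0 then Encodable.encode z / 2 else 0 :=
    Primrec.ite (Primrec.eq.comp (Primrec.nat_mod.comp Primrec.encode (Primrec.const 2))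
      (Primrec.const 0)) (Primrec.nat_div.comp Primrec.encode (Primrec.const 2)) (Primrec.const 0)
  refine h.of_eq fun z => ?_
  cases z with
  | ofNat n =>
    have : Encodable.encode (Int.ofNat n) = 2 * n := rfl
    rw [this]
    simp
  | negSucc n =>
    have : Encodable.encode (Int.negSucc n) = 2 * n + 1 := rfl
    rw [this, if_neg (by omega)]
    rfl

/-- The nonnegative rational coded by `c` in units of `1 / (k + 1)`, rounded down. -/
def fixedPoint (k : ℕ) (c : ℤ × ℕ) : ℕ := c.1.toNat * (k + 1) / (c.2 + 1)

theorem computable_fixedPoint : Computable₂ fixedPoint :=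
  (Primrec.nat_div.comp (Primrec.nat_mul.comp (primrec_toNat.comp (Primrec.fst.comp Primrec.snd))
    (Primrec.succ.comp Primrec.fst)) (Primrec.succ.comp (Primrec.snd.comp Primrec.snd))).to_comp

theorem abs_natDiv_sub_le {a b : ℕ} (hb : 0 < b) : |((a / b : ℕ) : ℝ) - a / b| ≤ 1 := by
  have hb' : (0 : ℝ) < b := by exact_mod_cast hb
  have h1 : ((a / b : ℕ) : ℝ) ≤ a / b := Nat.cast_div_le
  have h2 : (a : ℝ) < b * ((a / b : ℕ) + 1) := by exact_mod_cast Nat.lt_mul_div_succ a hb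
  have h3 : (a : ℝ) / b < (a / b : ℕ) + 1 := by
    rw [div_lt_iff₀ hb']
    linarith
  rw [abs_le]
  constructor <;> linarith

/-- One unit of error comes from the estimate and one from rounding down. Replacing negative
estimates by `0` does no harm because `v` is nonnegative. -/
theorem abs_fixedPoint_sub_le {v : ℝ} (hv : 0 ≤ v) {k : ℕ} {c : ℤ × ℕ}
    (h : |v - (ratOfCode c : ℝ)| < 1 / ((k : ℝ) + 1)) :
    |(fixedPoint k c : ℝ) - (k + 1) * v| ≤ 2 := by
  have hk : (0 : ℝ) < k + 1 := by positivity
  have hc : (0 : ℝ) < (c.2 : ℝ) + 1 := by positivity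
  have h1 := abs_natDiv_sub_le (a := c.1.toNat * (k + 1)) (b := c.2 + 1) (Nat.succ_pos _)
  have h2 : ((c.1.toNat * (k + 1) : ℕ) : ℝ) / ((c.2 + 1 : ℕ) : ℝ) =
      (k + 1) * max (ratOfCode c : ℝ) 0 := by
    have : ((c.1.toNat : ℕ) : ℝ) = max (c.1 : ℝ) 0 := by
      have := Int.toNat_eq_max c.1
      exact_mod_cast this
    push_cast
    rw [this, ratOfCode]
    push_cast
    rw [show max ((c.1 : ℝ) / ((c.2 : ℝ) + 1)) 0 = max (c.1 : ℝ) 0 / ((c.2 : ℝ) + 1) by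
      rw [← max_div_div_right hc.le, zero_div]]
    ring
  have h3 : |max (ratOfCode c : ℝ) 0 - v| ≤ 1 / (k + 1) := by
    have := abs_max_sub_max_le_abs (ratOfCode c : ℝ) v 0
    rw [max_eq_left hv, abs_sub_comm (ratOfCode c : ℝ) v] at this
    exact this.trans h.le
  have h4 : |(k + 1) * max (ratOfCode c : ℝ) 0 - (k + 1) * v| ≤ 1 := by
    rw [← mul_sub, abs_mul, abs_of_pos hk]
    calc ((k : ℝ) + 1) * _ ≤ (k + 1) * (1 / (k + 1)) := mul_le_mul_of_nonneg_left h3 hk.le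
      _ = 1 := by field_simp
  rw [h2] at h1
  calc |(fixedPoint k c : ℝ) - (k + 1) * v| ≤ _ := abs_sub_le _ _ _
    _ ≤ 1 + 1 := add_le_add h1 h4
    _ = 2 := by norm_num

theorem Estimable.exists_fixedPoint {α : Type*} [Primcodable α] {f : α → ℝ} (hf : Estimable f)
    (h0 : ∀ x, 0 ≤ f x) :
    ∃ g : α → ℕ → ℕ, Computable₂ g ∧ ∀ x k, |(g x k : ℝ) - (k + 1) * f x| ≤ 2 := by
  obtain ⟨φ, hφ, h⟩ := hf
  exact ⟨fun x k => fixedPoint k (φ (x, k)), computable_fixedPoint.comp Computable.snd hφ,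
    fun x k => abs_fixedPoint_sub_le (h0 x) (h x k)⟩

theorem OEstimableOn.oracleSolvable {A E : Type*} [Primcodable A] [Primcodable E]
    {O : Oracle A E} {α : Type*} [Primcodable α] {D : Set α} {f : α → ℝ}
    (hf : OEstimableOn O D f) (h0 : ∀ x ∈ D, 0 ≤ f x) :
    OracleSolvable O {p : α × ℕ | p.1 ∈ D}
      fun p => {y : ℕ | |(y : ℝ) - (p.2 + 1) * f p.1| ≤ 2} := by
  have h1 : OracleSolvable O {p : α × ℕ | p.1 ∈ D}
      fun p => {c : ℤ × ℕ | |f p.1 - (ratOfCode c : ℝ)| < 1 / ((p.2 : ℝ) + 1)} := by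
    obtain ⟨T, hT⟩ := hf
    refine ⟨T, fun p hp => ?_⟩
    refine Eq.trans ?_ (hT p.1 hp p.2)
    congr 1
    ext m
    exact exists_congr fun c => and_comm
  exact h1.map (f := fun z : (α × ℕ) × (ℤ × ℕ) => fixedPoint z.1.2 z.2) (computable_fixedPoint.comp
    (Computable.snd.comp Computable.fst) Computable.snd) fun p hp c hc =>
      abs_fixedPoint_sub_le (h0 _ hp) hc

/-- The fixed-point error of the approximate product `x * (g * ρ + y)`, clipped at `B`. -/
theorem abs_product_sub_le {N x g ρ y B : ℕ} (hN : 0 < N) {p c s w δ : ℝ} (hp0 : 0 ≤ p)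
    (hc0 : 0 ≤ c) (hcB : c ≤ B) (hs1 : s ≤ 1) (hv : c * s + w ≤ B)
    (hx : |(x : ℝ) - N * p| ≤ 2) (hg : |(g : ℝ) - N * c| ≤ 4) (hρ : |(ρ : ℝ) - N * s| ≤ 2)
    (hy : |(y : ℝ) - N * w| ≤ δ) :
    |((x * min (g * ρ / N + y) (B * N) / N : ℕ) : ℝ) - N * (p * (c * s + w))| ≤
      p * (δ + (13 + 2 * B)) + (4 * B + 1) := by
  have hN0 : (0 : ℝ) < N := by exact_mod_cast hN
  have hN1 : (1 : ℝ) ≤ N := by exact_mod_cast hN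
  have hB : (0 : ℝ) ≤ B := B.cast_nonneg
  have hρN : (ρ : ℝ) ≤ 3 * N := by
    have := (abs_le.1 hρ).2
    nlinarith
  -- The error `4` of `g` meets `ρ ≤ 3 * N`, and the error `2` of `ρ` meets `N * c ≤ N * B`.
  -- Dividing by `N` and rounding down gives `13 + 2 * B`.
  have h1 : |(g : ℝ) * ρ - N * (N * (c * s))| ≤ N * (12 + 2 * B) := by
    have : (g : ℝ) * ρ - N * (N * (c * s)) = (g - N * c) * ρ + N * c * (ρ - N * s) := by ring
    rw [this]
    refine (abs_add_le _ _).trans ?_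
    rw [abs_mul, abs_mul, abs_of_nonneg (Nat.cast_nonneg ρ : (0 : ℝ) ≤ ρ),
      abs_of_nonneg (mul_nonneg hN0.le hc0)]
    have e1 : |(g : ℝ) - N * c| * ρ ≤ 4 * (3 * N) :=
      mul_le_mul hg hρN (Nat.cast_nonneg _) (by norm_num)
    have e2 : N * c * |(ρ : ℝ) - N * s| ≤ N * B * 2 :=
      mul_le_mul (mul_le_mul_of_nonneg_left hcB hN0.le) hρ (abs_nonneg _) (by positivity)
    linarith
  have h2 : |(g : ℝ) * ρ / N - N * (c * s)| ≤ 12 + 2 * B := by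
    have : (g : ℝ) * ρ / N - N * (c * s) = (g * ρ - N * (N * (c * s))) / N := by field_simp
    rw [this, abs_div, abs_of_pos hN0, div_le_iff₀ hN0]
    linarith
  have h3 := abs_natDiv_sub_le (a := g * ρ) hN
  push_cast at h3
  have h4 : |((g * ρ / N + y : ℕ) : ℝ) - N * (c * s + w)| ≤ δ + (13 + 2 * B) := by
    push_cast
    rw [abs_le] at *
    constructor <;> linarith
  -- Clipping cannot increase the error, as the true value is at most `B`. It bounds the factor that
  -- multiplies the error of `x`, so the inherited error `δ` is weighted by exactly `p` and will
  -- average, not grow, when summed over percepts.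
  set t := min (g * ρ / N + y) (B * N) with ht
  have h5 : |(t : ℝ) - N * (c * s + w)| ≤ δ + (13 + 2 * B) := by
    have h6 : (N : ℝ) * (c * s + w) ≤ ((B * N : ℕ) : ℝ) := by
      push_cast
      nlinarith
    have := abs_min_sub_min_le_max ((g * ρ / N + y : ℕ) : ℝ) ((B * N : ℕ) : ℝ)
      (N * (c * s + w)) ((B * N : ℕ) : ℝ)
    rw [min_eq_left h6, sub_self, abs_zero, max_eq_left (abs_nonneg _)] at this
    rw [ht, Nat.cast_min]
    exact this.trans h4
  have htB : (t : ℝ) ≤ B * N := by exact_mod_cast min_le_right _ _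
  have h6 : |(x : ℝ) * t / N - N * (p * (c * s + w))| ≤ p * (δ + (13 + 2 * B)) + 2 * B := by
    have : (x : ℝ) * t / N - N * (p * (c * s + w)) =
        ((x - N * p) * t + N * (p * (t - N * (c * s + w)))) / N := by
      field_simp
      ring
    rw [this, abs_div, abs_of_pos hN0, div_le_iff₀ hN0]
    refine (abs_add_le _ _).trans ?_
    rw [abs_mul, abs_mul, abs_mul, abs_of_pos hN0, abs_of_nonneg hp0,
      abs_of_nonneg (Nat.cast_nonneg t : (0 : ℝ) ≤ t)]
    have e1 : |(x : ℝ) - N * p| * t ≤ 2 * (B * N) :=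
      mul_le_mul hx htB (Nat.cast_nonneg _) (by norm_num)
    have e2 : N * (p * |(t : ℝ) - N * (c * s + w)|) ≤ N * (p * (δ + (13 + 2 * B))) := by
      gcongr
    linarith
  have h7 := abs_natDiv_sub_le (a := x * t) hN
  push_cast at h7 ⊢
  rw [abs_le] at *
  constructor <;> linarith

theorem abs_natSub_sub_le {a b : ℕ} {x y : ℝ} (hxy : y ≤ x) (ha : |(a : ℝ) - x| ≤ 2)
    (hb : |(b : ℝ) - y| ≤ 2) : |((a - b : ℕ) : ℝ) - (x - y)| ≤ 4 := by
  rw [abs_le] at *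
  rcases le_total a b with h | h
  · have h' : (a : ℝ) ≤ b := by exact_mod_cast h
    rw [Nat.sub_eq_zero_of_le h, Nat.cast_zero]
    constructor <;> linarith
  · rw [Nat.cast_sub h]
    constructor <;> linarith

theorem abs_sum_sub_sum_le {ι : Type*} {c d : ι → ℝ} {l : List ι} {zs : List ℕ}
    (h : List.Forall₂ (fun j (z : ℕ) => |(z : ℝ) - c j| ≤ d j) l zs) :
    |((zs.sum : ℕ) : ℝ) - (l.map c).sum| ≤ (l.map d).sum := by
  induction h with
  | nil => simp
  | cons h _ ih =>
    simp only [List.sum_cons, List.map_cons, Nat.cast_add]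
    rw [abs_le] at *
    constructor <;> linarith

/-- A maximum moves by no more than its entries do; starting the fold at `0` is harmless because all
`q j` are nonnegative. -/
theorem abs_max_sub_iSup_le {ι : Type*} [Fintype ι] [Nonempty ι] {q : ι → ℝ} (hq : ∀ j, 0 ≤ q j)
    {δ : ℝ} (hδ : 0 ≤ δ) {ys : List ℕ} {N : ℝ} (hN : 0 ≤ N)
    (h : List.Forall₂ (fun j (y : ℕ) => |(y : ℝ) - N * q j| ≤ δ) Finset.univ.toList ys) :
    |((ys.foldr max 0 : ℕ) : ℝ) - N * ⨆ j, q j| ≤ δ := by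
  have hb : BddAbove (Set.range q) := (Set.finite_range q).bddAbove
  have key : ∀ l ys, List.Forall₂ (fun j (y : ℕ) => |(y : ℝ) - N * q j| ≤ δ) l ys →
      ((ys.foldr max 0 : ℕ) : ℝ) ≤ N * (⨆ j, q j) + δ ∧
        ∀ j ∈ l, N * q j ≤ ((ys.foldr max 0 : ℕ) : ℝ) + δ := by
    intro l ys h
    induction h with
    | nil =>
      refine ⟨?_, by simp⟩
      have := mul_nonneg hN (Real.iSup_nonneg hq)
      simp only [List.foldr_nil, Nat.cast_zero]
      linarith
    | @cons j y l ys h _ ih =>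
      have h1 := mul_le_mul_of_nonneg_left (le_ciSup hb j) hN
      rw [abs_le] at h
      simp only [List.foldr_cons, Nat.cast_max]
      refine ⟨max_le (by linarith) ih.1, fun j' hj' => ?_⟩
      rcases List.mem_cons.1 hj' with rfl | hj'
      · linarith [le_max_left (y : ℝ) ((ys.foldr max 0 : ℕ) : ℝ)]
      · linarith [ih.2 j' hj', le_max_right (y : ℝ) ((ys.foldr max 0 : ℕ) : ℝ)]
  obtain ⟨h1, h2⟩ := key _ _ h
  obtain ⟨j, hj⟩ := exists_eq_ciSup_of_finite (f := q)
  have h3 := h2 j (by simp)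
  rw [hj] at h3
  rw [abs_le]
  constructor <;> linarith

end FixedPoint

/-! ## A machine that approximates the finite-horizon values -/

section ValueMachine

variable {A E : Type*} [Fintype A] [Primcodable A] [Fintype E] [Primcodable E]

/-- The admissible approximations of the value for horizon `p.1` at the history `p.2.2` in units of
`1 / (p.2.1 + 1)`. -/
def valueApprox (γ : ℕ → ℝ) (r : E → ℝ) (ν : Environment A E) (K : ℕ)
    (p : ℕ × ℕ × List (A × E)) : Set ℕ :=
  {y | |(y : ℝ) - ((p.2.1 + 1 : ℕ) : ℝ) * horizonValue γ r ν p.1 p.2.2| ≤ p.1 * K}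

/-- The inputs whose first component approximates the values for the horizon `p.2.1`. -/
def callDomain (O : Oracle A E) (γ : ℕ → ℝ) (r : E → ℝ) (ν : Environment A E) (K : ℕ) :
    Set (PTM × ℕ × ℕ × List (A × E)) :=
  {p | p.2.2.2 ∈ ν.dom ∧ ∀ h ∈ ν.dom,
    p.1.Solves O (p.2.1, p.2.2.1, h) (valueApprox γ r ν K (p.2.1, p.2.2.1, h))}

variable {O : Oracle A E} {γ : ℕ → ℝ} {r : E → ℝ} {ν : Environment A E} {g : ℕ → ℕ → ℕ}
  {ρ : E → ℕ → ℕ} {B K : ℕ}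

/-- One summand of the Bellman expectation, computed by estimating the conditional probability first
and making the recursive call only if that probability is certainly positive. -/
theorem oracleSolvable_term (hγ : ∀ t, 0 ≤ γ t) (hs : Summable γ)
    (hr : ∀ e, 0 ≤ r e ∧ r e ≤ 1) (hg : Computable₂ g)
    (hgγ : ∀ t k, |(g t k : ℝ) - ((k + 1 : ℕ) : ℝ) * γ t| ≤ 4) (hρ : Computable₂ ρ)
    (hρr : ∀ e k, |(ρ e k : ℝ) - ((k + 1 : ℕ) : ℝ) * r e| ≤ 2) (hB : discountNorm γ 0 ≤ B)
    (hν : ν.OEstimableConditionals O) [Nonempty A] (a : A) (e : E) :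
    OracleSolvable O (callDomain O γ r ν K) fun p => {z : ℕ |
      |(z : ℝ) - ((p.2.2.1 + 1 : ℕ) : ℝ) * (ν.cond p.2.2.2 a e *
        (γ p.2.2.2.length * r e + horizonValue γ r ν p.2.1 (p.2.2.2 ++ [(a, e)])))| ≤
      ν.cond p.2.2.2 a e * (p.2.1 * K + (13 + 2 * B)) + (4 * B + 1)} := by
  have hB0 : (0 : ℝ) ≤ B := B.cast_nonneg
  have hest := hν.oracleSolvable fun z hz => ν.cond_nonneg z.1 hz z.2.1 z.2.2
  have hpk : Computable fun p : PTM × ℕ × ℕ × List (A × E) => p.2.2.1 :=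
    Computable.fst.comp (Computable.snd.comp Computable.snd)
  have hph : Computable fun p : PTM × ℕ × ℕ × List (A × E) => p.2.2.2 :=
    Computable.snd.comp (Computable.snd.comp Computable.snd)
  have hpn : Computable fun p : PTM × ℕ × ℕ × List (A × E) => p.2.1 :=
    Computable.fst.comp Computable.snd
  have h1 := hest.comp (D := callDomain O γ r ν K) (f := fun p => ((p.2.2.2, a, e), p.2.2.1))
    ((hph.pair (Computable.const (a, e))).pair hpk) fun p hp => hp.1
  have hbound : ∀ (h : List (A × E)) (n : ℕ), h ∈ ν.dom → 0 < ν.cond h a e →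
      γ h.length * r e + horizonValue γ r ν n (h ++ [(a, e)]) ≤ B := by
    intro h n hh hpos
    have e1 := horizonValue_add_le hγ hs hr n 0 (ν.append_mem h hh a e hpos)
    have e2 := discountNorm_eq_add hs h.length
    have e3 := discountNorm_antitone hγ hs (Nat.zero_le h.length)
    have e4 := mul_le_of_le_one_right (hγ h.length) (hr e).2
    simp only [horizonValue, List.length_append, List.length_singleton, add_zero,
      zero_add] at e1
    linarith
  have hK0 : ∀ n : ℕ, (0 : ℝ) ≤ n * K := fun n => by positivity
  refine h1.bind (D' := {z : (PTM × ℕ × ℕ × List (A × E)) × ℕ | z.1 ∈ callDomain O γ r ν K ∧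
      |(z.2 : ℝ) - (z.1.2.2.1 + 1) * ν.cond z.1.2.2.2 a e| ≤ 2})
    (R' := fun z => {y : ℕ | |(y : ℝ) - ((z.1.2.2.1 + 1 : ℕ) : ℝ) * (ν.cond z.1.2.2.2 a e *
        (γ z.1.2.2.2.length * r e + horizonValue γ r ν z.1.2.1 (z.1.2.2.2 ++ [(a, e)])))| ≤
      ν.cond z.1.2.2.2 a e * (z.1.2.1 * K + (13 + 2 * B)) + (4 * B + 1)})
    ?_ fun p hp x hx => ⟨⟨hp, hx⟩, subset_rfl⟩
  -- The estimate has error at most `2`. If it is at least `3`, the probability is positive and the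
  -- continuation lies in `ν.dom`. If it is at most `2`, the scaled probability is at most `4`, so
  -- the whole term is at most `4 * B` and may be replaced by `0`.
  refine OracleSolvable.cond (c := fun z => decide (z.2 < 3))
    (Primrec.nat_lt.decide.comp Primrec.snd (Primrec.const 3)).to_comp ?_ ?_
  · refine .pure (Computable.const 0) ?_
    rintro ⟨⟨S, n, k, h⟩, x⟩ ⟨⟨⟨hh, -⟩, hx⟩, hx3⟩
    have hx2 : x ≤ 2 := by
      have := of_decide_eq_true hx3
      simp only at this
      omega
    have hx2' : (x : ℝ) ≤ 2 := by exact_mod_cast hx2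
    simp only [Set.mem_ofPred_eq] at hx hh ⊢
    have hp0 := ν.cond_nonneg h hh a e
    rcases hp0.eq_or_lt with h0 | h0
    · rw [← h0]
      simp only [CharP.cast_eq_zero, zero_mul, mul_zero, sub_zero, abs_zero, zero_add]
      positivity
    · have hb := hbound h n hh h0
      have hw := horizonValue_nonneg hγ hr n (ν.append_mem h hh a e h0)
      have hv : 0 ≤ γ h.length * r e + horizonValue γ r ν n (h ++ [(a, e)]) :=
        add_nonneg (mul_nonneg (hγ _) (hr e).1) hw
      have h4 : ((k : ℝ) + 1) * ν.cond h a e ≤ 4 := by linarith [(abs_le.1 hx).1]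
      have h5 : ((k : ℝ) + 1) * ν.cond h a e *
          (γ h.length * r e + horizonValue γ r ν n (h ++ [(a, e)])) ≤ 4 * B :=
        mul_le_mul h4 hb hv (by norm_num)
      have h6 : 0 ≤ ((k : ℝ) + 1) * ν.cond h a e *
          (γ h.length * r e + horizonValue γ r ν n (h ++ [(a, e)])) := by positivity
      have h7 : 0 ≤ ν.cond h a e * (n * K + (13 + 2 * B)) := by
        have := hK0 n
        positivity
      push_cast
      rw [zero_sub, abs_neg, ← mul_assoc, abs_of_nonneg h6]
      linarith
  · have hz : Computable fun z : (PTM × ℕ × ℕ × List (A × E)) × ℕ => z.1 := Computable.fst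
    have hcall : OracleSolvable O {z : (PTM × ℕ × ℕ × List (A × E)) × ℕ |
        z.1 ∈ callDomain O γ r ν K ∧ z.1.2.2.2 ++ [(a, e)] ∈ ν.dom} fun z =>
          valueApprox γ r ν K (z.1.2.1, z.1.2.2.1, z.1.2.2.2 ++ [(a, e)]) :=
      .call (s := fun z => z.1.1) (Computable.fst.comp Computable.fst)
        (f := fun z => (z.1.2.1, z.1.2.2.1, z.1.2.2.2 ++ [(a, e)]))
        ((hpn.comp hz).pair ((hpk.comp hz).pair
          (Computable.list_append.comp (hph.comp hz) (Computable.const [(a, e)]))))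
        fun z hz => hz.1.2 _ hz.2
    have hpos : ∀ z ∈ {z ∈ {z : (PTM × ℕ × ℕ × List (A × E)) × ℕ | z.1 ∈ callDomain O γ r ν K ∧
        |(z.2 : ℝ) - (z.1.2.2.1 + 1) * ν.cond z.1.2.2.2 a e| ≤ 2} | decide (z.2 < 3) = false},
        0 < ν.cond z.1.2.2.2 a e := by
      rintro ⟨⟨S, n, k, h⟩, x⟩ ⟨⟨-, hx⟩, hx3⟩
      have hx2 : 3 ≤ x := not_lt.1 (of_decide_eq_false hx3)
      have hx2' : (3 : ℝ) ≤ x := by exact_mod_cast hx2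
      simp only at hx ⊢
      have : 0 < ((k : ℝ) + 1) * ν.cond h a e := by linarith [(abs_le.1 hx).2]
      exact pos_of_mul_pos_right this (by positivity)
    have hN : Computable fun q : ((PTM × ℕ × ℕ × List (A × E)) × ℕ) × ℕ => q.1.1.2.2.1 + 1 :=
      Computable.succ.comp (hpk.comp (hz.comp Computable.fst))
    have hgq : Computable fun q : ((PTM × ℕ × ℕ × List (A × E)) × ℕ) × ℕ =>
        g q.1.1.2.2.2.length q.1.1.2.2.1 :=
      hg.comp (Computable.list_length.comp (hph.comp (hz.comp Computable.fst)))
        (hpk.comp (hz.comp Computable.fst))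
    have hρq : Computable fun q : ((PTM × ℕ × ℕ × List (A × E)) × ℕ) × ℕ =>
        ρ e q.1.1.2.2.1 :=
      hρ.comp (Computable.const e) (hpk.comp (hz.comp Computable.fst))
    refine (hcall.mono (D' := {z ∈ {z : (PTM × ℕ × ℕ × List (A × E)) × ℕ |
        z.1 ∈ callDomain O γ r ν K ∧ |(z.2 : ℝ) - (z.1.2.2.1 + 1) * ν.cond z.1.2.2.2 a e| ≤ 2} |
          decide (z.2 < 3) = false})
      (fun z hz => ⟨hz.1.1, ν.append_mem _ hz.1.1.1 _ _ (hpos z hz)⟩)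
      fun _ _ => subset_rfl).map
      (f := fun q => q.1.2 * min (g q.1.1.2.2.2.length q.1.1.2.2.1 * ρ e q.1.1.2.2.1 /
        (q.1.1.2.2.1 + 1) + q.2) (B * (q.1.1.2.2.1 + 1)) / (q.1.1.2.2.1 + 1)) ?_ ?_
    · exact Primrec.nat_div.to_comp.comp (Primrec.nat_mul.to_comp.comp
        (Computable.snd.comp Computable.fst) (Primrec.nat_min.to_comp.comp
          (Primrec.nat_add.to_comp.comp (Primrec.nat_div.to_comp.comp
            (Primrec.nat_mul.to_comp.comp hgq hρq) hN) Computable.snd)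
          (Primrec.nat_mul.to_comp.comp (Computable.const B) hN))) hN
    · intro z hz y hy
      have hp := hpos z hz
      obtain ⟨⟨S, n, k, h⟩, x⟩ := z
      obtain ⟨⟨⟨hh, -⟩, hx⟩, -⟩ := hz
      refine abs_product_sub_le (Nat.succ_pos k) hp.le (hγ _) ?_ (hr e).2 (hbound h n hh hp) ?_
        (hgγ _ _) (hρr _ _) hy
      · have e2 := discountNorm_eq_add hs h.length
        have e3 := discountNorm_antitone hγ hs (Nat.zero_le h.length)
        have e4 := discountNorm_nonneg hγ (h.length + 1)
        linarith
      · simpa using hx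

/-- Summing over percepts, the part of the error weighted by probabilities is averaged, while the
unweighted part `4 * B + 1` occurs once per percept. So each round adds the same constant `K`, and
the error grows only linearly in the horizon. -/
theorem oracleSolvable_actionValue_of_call (hγ : ∀ t, 0 ≤ γ t) (hs : Summable γ)
    (hr : ∀ e, 0 ≤ r e ∧ r e ≤ 1) (hg : Computable₂ g)
    (hgγ : ∀ t k, |(g t k : ℝ) - ((k + 1 : ℕ) : ℝ) * γ t| ≤ 4) (hρ : Computable₂ ρ)
    (hρr : ∀ e k, |(ρ e k : ℝ) - ((k + 1 : ℕ) : ℝ) * r e| ≤ 2) (hB : discountNorm γ 0 ≤ B)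
    (hν : ν.OEstimableConditionals O) [Nonempty A]
    (hK : K = 13 + 2 * B + Fintype.card E * (4 * B + 1)) (a : A) :
    OracleSolvable O (callDomain O γ r ν K) fun p => {z : ℕ |
      |(z : ℝ) - ((p.2.2.1 + 1 : ℕ) : ℝ) *
        actionValue γ r ν (horizonValue γ r ν p.2.1) p.2.2.2 a| ≤ ((p.2.1 + 1 : ℕ) : ℝ) * K} := by
  have h := OracleSolvable.list (Finset.univ : Finset E).toList fun e _ =>
    oracleSolvable_term (K := K) hγ hs hr hg hgγ hρ hρr hB hν a e
  refine h.map (f := fun q => q.2.sum) ?_ ?_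
  · have : Primrec fun l : List ℕ => l.foldr (· + ·) 0 :=
      Primrec.list_foldr Primrec.id (Primrec.const 0)
        (Primrec.nat_add.comp (Primrec.fst.comp Primrec.snd) (Primrec.snd.comp Primrec.snd)).to₂
    exact (this.of_eq fun l => (List.sum_eq_foldr (l := l)).symm).to_comp.comp Computable.snd
  · rintro ⟨S, n, k, h⟩ ⟨hh, -⟩ zs hzs
    have h1 := abs_sum_sub_sum_le hzs
    rw [Finset.sum_map_toList, Finset.sum_map_toList, ← Finset.mul_sum, Finset.sum_add_distrib,
      ← Finset.sum_mul, ν.cond_sum h hh a] at h1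
    refine h1.trans (le_of_eq ?_)
    simp only [Finset.sum_const, Finset.card_univ, nsmul_eq_mul, hK]
    push_cast
    ring

theorem exists_solves_valueApprox (hγ : ∀ t, 0 ≤ γ t) (hs : Summable γ)
    (hr : ∀ e, 0 ≤ r e ∧ r e ≤ 1) (hg : Computable₂ g)
    (hgγ : ∀ t k, |(g t k : ℝ) - ((k + 1 : ℕ) : ℝ) * γ t| ≤ 4) (hρ : Computable₂ ρ)
    (hρr : ∀ e k, |(ρ e k : ℝ) - ((k + 1 : ℕ) : ℝ) * r e| ≤ 2) (hB : discountNorm γ 0 ≤ B)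
    (hν : ν.OEstimableConditionals O) [Nonempty A]
    (hK : K = 13 + 2 * B + Fintype.card E * (4 * B + 1)) :
    ∃ T : PTM, ∀ n k, ∀ h ∈ ν.dom, T.Solves O (n, k, h) (valueApprox γ r ν K (n, k, h)) := by
  -- One step of the recursion, for a machine `p.1` assumed correct for the previous horizon.
  -- Kleene's theorem then takes `p.1` to be the machine itself, and induction on the horizon
  -- discharges the assumption.
  have hstep : OracleSolvable O {p : PTM × ℕ × ℕ × List (A × E) |
      p.2.1 ≠ 0 → (p.1, p.2.1 - 1, p.2.2) ∈ callDomain O γ r ν K}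
      fun p => valueApprox γ r ν K p.2 := by
    refine OracleSolvable.cond (c := fun p => decide (p.2.1 = 0))
      (Primrec.eq.decide.comp (Primrec.fst.comp Primrec.snd) (Primrec.const 0)).to_comp ?_ ?_
    · refine .pure (Computable.const 0) ?_
      rintro ⟨S, n, k, h⟩ ⟨-, hn⟩
      have hn : n = 0 := of_decide_eq_true hn
      subst hn
      simp [valueApprox, horizonValue]
    · have h := OracleSolvable.list (Finset.univ : Finset A).toList fun a _ =>
        oracleSolvable_actionValue_of_call hγ hs hr hg hgγ hρ hρr hB hν hK a
      have hf : Computable fun p : PTM × ℕ × ℕ × List (A × E) => (p.1, p.2.1 - 1, p.2.2) :=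
        Computable.fst.pair ((Computable.pred.comp (Computable.fst.comp Computable.snd)).pair
          (Computable.snd.comp Computable.snd))
      refine (h.comp (D := {p ∈ {p : PTM × ℕ × ℕ × List (A × E) |
        p.2.1 ≠ 0 → (p.1, p.2.1 - 1, p.2.2) ∈ callDomain O γ r ν K} |
          decide (p.2.1 = 0) = false}) hf
        fun p hp => hp.1 (of_decide_eq_false hp.2)).map (f := fun q => q.2.foldr max 0) ?_ ?_
      · have : Primrec fun l : List ℕ => l.foldr max 0 :=
          Primrec.list_foldr Primrec.id (Primrec.const 0)
            (Primrec.nat_max.comp (Primrec.fst.comp Primrec.snd) (Primrec.snd.comp Primrec.snd)).to₂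
        exact this.to_comp.comp Computable.snd
      · rintro ⟨S, n, k, h⟩ ⟨hD, hn⟩ ys hys
        have hn : n ≠ 0 := of_decide_eq_false hn
        obtain ⟨n, rfl⟩ := Nat.exists_eq_succ_of_ne_zero hn
        have hh : h ∈ ν.dom := (hD hn).1
        exact abs_max_sub_iSup_le (fun a => actionValue_nonneg hγ hr hh a
          fun e he => horizonValue_nonneg hγ hr n he) (by positivity) (by positivity) hys
  obtain ⟨T, hT⟩ := hstep.recursion
  refine ⟨T, fun n k => ?_⟩
  induction n with
  | zero => exact fun h _ => hT (0, k, h) fun h0 => absurd rfl h0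
  | succ n ih => exact fun h hh => hT (n + 1, k, h) fun _ => ⟨hh, ih⟩

theorem oracleSolvable_actionValue (hγ : ∀ t, 0 ≤ γ t) (hs : Summable γ)
    (hr : ∀ e, 0 ≤ r e ∧ r e ≤ 1) (hr_est : Estimable r)
    (hΓ_est : Estimable (discountNorm γ)) (hν : ν.OEstimableConditionals O) [Nonempty A] :
    ∃ K : ℕ, ∀ a, OracleSolvable O {p : ℕ × ℕ × List (A × E) | p.2.2 ∈ ν.dom} fun p => {z : ℕ |
      |(z : ℝ) - ((p.2.1 + 1 : ℕ) : ℝ) * actionValue γ r ν (horizonValue γ r ν p.1) p.2.2 a| ≤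
        ((p.1 + 1 : ℕ) : ℝ) * K} := by
  obtain ⟨G, hG, hGΓ⟩ := hΓ_est.exists_fixedPoint (discountNorm_nonneg hγ)
  obtain ⟨ρ, hρ, hρr⟩ := hr_est.exists_fixedPoint fun e => (hr e).1
  obtain ⟨B, hB⟩ := exists_nat_ge (discountNorm γ 0)
  -- Only `Γ` is assumed estimable; `γ t` is recovered as a difference of consecutive values, which
  -- doubles the error to `4`.
  have hg : Computable₂ fun t k => G t k - G (t + 1) k :=
    Primrec.nat_sub.to_comp.comp (hG.comp Computable.fst Computable.snd)
      (hG.comp (Computable.succ.comp Computable.fst) Computable.snd)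
  have hgγ : ∀ t k, |((G t k - G (t + 1) k : ℕ) : ℝ) - ((k + 1 : ℕ) : ℝ) * γ t| ≤ 4 := by
    intro t k
    have h1 := discountNorm_eq_add hs t
    have h2 : ((k + 1 : ℕ) : ℝ) * γ t =
        (k + 1) * discountNorm γ t - (k + 1) * discountNorm γ (t + 1) := by
      rw [h1]
      push_cast
      ring
    rw [h2]
    refine abs_natSub_sub_le ?_ (hGΓ t k) (hGΓ (t + 1) k)
    exact mul_le_mul_of_nonneg_left (discountNorm_antitone hγ hs (Nat.le_succ t)) (by positivity)
  have hρr' : ∀ e k, |(ρ e k : ℝ) - ((k + 1 : ℕ) : ℝ) * r e| ≤ 2 := fun e k => by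
    simpa using hρr e k
  refine ⟨13 + 2 * B + Fintype.card E * (4 * B + 1), fun a => ?_⟩
  obtain ⟨T, hT⟩ := exists_solves_valueApprox hγ hs hr hg hgγ hρ hρr' hB hν rfl
  exact (oracleSolvable_actionValue_of_call hγ hs hr hg hgγ hρ hρr' hB hν rfl a).comp
    (f := fun p => (T, p)) ((Computable.const T).pair Computable.id)
    fun p hp => ⟨hp, hT p.1 p.2.1⟩

end ValueMachine

/-! ## Reading histories -/

section Histories

variable {A E : Type*}

/-- The history written in a string. -/
def parseHistory (x : List (A ⊕ E)) : List (A × E) :=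
  (x.foldr (fun z (s : Option E × List (A × E)) =>
    (Sum.casesOn z (fun a => Option.casesOn s.1 s fun e => (none, (a, e) :: s.2))
      fun e => (some e, s.2) : Option E × List (A × E))) (none, [])).2

theorem parseHistory_historyString (h : List (A × E)) : parseHistory (historyString h) = h := by
  have key : (historyString h).foldr (fun z (s : Option E × List (A × E)) =>
      (Sum.casesOn z (fun a => Option.casesOn s.1 s fun e => (none, (a, e) :: s.2))
        fun e => (some e, s.2) : Option E × List (A × E))) (none, []) = (none, h) := by
    induction h with
    | nil => rfl
    | cons z h ih =>
      have : historyString (z :: h) = .inl z.1 :: .inr z.2 :: historyString h := rfl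
      rw [this, List.foldr_cons, List.foldr_cons, ih]
  rw [parseHistory, key]

theorem computable_parseHistory [Primcodable A] [Primcodable E] :
    Computable (parseHistory (A := A) (E := E)) := by
  refine (Primrec.snd.comp (Primrec.list_foldr
    (h := fun (_ : List (A ⊕ E)) (p : (A ⊕ E) × (Option E × List (A × E))) =>
      (Sum.casesOn p.1 (fun a => Option.casesOn p.2.1 p.2 fun e => (none, (a, e) :: p.2.2))
        fun e => (some e, p.2.2) : Option E × List (A × E)))
    Primrec.id (Primrec.const (none, [])) ?_)).to_comp
  refine Primrec.sumCasesOn (Primrec.fst.comp Primrec.snd) ?_ ?_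
  · have hs : Primrec fun q : (List (A ⊕ E) × (A ⊕ E) × (Option E × List (A × E))) × A =>
        q.1.2.2 := Primrec.snd.comp (Primrec.snd.comp Primrec.fst)
    refine Primrec.option_casesOn (Primrec.fst.comp hs) hs ?_
    exact (Primrec.const none).pair (Primrec.list_cons.comp
      ((Primrec.snd.comp Primrec.fst).pair Primrec.snd)
      (Primrec.snd.comp (hs.comp Primrec.fst)))
  · exact (Primrec.option_some.comp Primrec.snd).pair
      (Primrec.snd.comp (Primrec.snd.comp (Primrec.snd.comp Primrec.fst)))

end Histories

/-! ## Comparing two actions -/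

section Comparison

variable {A E : Type*} [Fintype A] [Fintype E] {γ : ℕ → ℝ} {r : E → ℝ} {ν : Environment A E}

/-- Soundness of the comparison. The margin covers the error `D` of each estimate and, for `b`, the
tail that its finite-horizon value may miss, bounded by `g + 2`. For `a` no tail is needed, because
a finite-horizon value is a lower bound. -/
theorem actionValue_lt_of_approx (hγ : ∀ t, 0 ≤ γ t) (hs : Summable γ)
    (hr : ∀ e, 0 ≤ r e ∧ r e ≤ 1) [Nonempty A] {h : List (A × E)} (hh : h ∈ ν.dom) {a b : A}
    {s N y z g D : ℕ}
    (hy : |(y : ℝ) - N * actionValue γ r ν (horizonValue γ r ν s) h a| ≤ D)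
    (hz : |(z : ℝ) - N * actionValue γ r ν (horizonValue γ r ν s) h b| ≤ D)
    (hg : |(g : ℝ) - N * discountNorm γ (h.length + 1 + s)| ≤ 2) (hlt : z + 2 * D + g + 2 < y) :
    actionValue γ r ν (optimalValue γ r ν) h b < actionValue γ r ν (optimalValue γ r ν) h a := by
  have hlt' : (z : ℝ) + 2 * D + g + 2 < y := by exact_mod_cast hlt
  have hN : (0 : ℝ) ≤ N := N.cast_nonneg
  have ha := mul_le_mul_of_nonneg_left (actionValue_horizonValue_mem hγ hs hr s hh a).1 hN
  have hb := mul_le_mul_of_nonneg_left (actionValue_horizonValue_mem hγ hs hr s hh b).2 hN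
  rw [abs_le] at *
  refine lt_of_mul_lt_mul_left (a := (N : ℝ)) ?_ hN
  linarith

/-- Completeness of the comparison. At stage `s` the error is `(s + 1) * K` units of size `1 / (s +
1) ^ 2`, so it tends to zero together with the tail, and eventually any admissible estimates exceed
the margin. -/
theorem exists_forall_approx_lt (hγ : ∀ t, 0 ≤ γ t) (hs : Summable γ)
    (hr : ∀ e, 0 ≤ r e ∧ r e ≤ 1) [Nonempty A] {h : List (A × E)} (hh : h ∈ ν.dom) {a b : A}
    (K : ℕ) (hlt : actionValue γ r ν (optimalValue γ r ν) h b <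
      actionValue γ r ν (optimalValue γ r ν) h a) :
    ∃ s₀ : ℕ, ∀ s ≥ s₀, ∀ y z g N D : ℕ, N = (s + 1) * (s + 1) → D = (s + 1) * K →
      |(y : ℝ) - N * actionValue γ r ν (horizonValue γ r ν s) h a| ≤ D →
      |(z : ℝ) - N * actionValue γ r ν (horizonValue γ r ν s) h b| ≤ D →
      |(g : ℝ) - N * discountNorm γ (h.length + 1 + s)| ≤ 2 → z + 2 * D + g + 2 < y := by
  set d := actionValue γ r ν (optimalValue γ r ν) h a -
    actionValue γ r ν (optimalValue γ r ν) h b with hd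
  have hd0 : 0 < d := sub_pos.2 hlt
  -- The tail is paid twice, once in the estimate for `a` and once in `g`, which costs less than `d
  -- / 4`. The choice of `s₂` makes the remaining errors, `4 * D + 4` units, at most `d / 2`.
  have h1 : ∀ᶠ s in Filter.atTop, discountNorm γ s < d / 8 :=
    tendsto_discountNorm.eventually (gt_mem_nhds (by positivity))
  obtain ⟨s₁, h1⟩ := Filter.eventually_atTop.1 h1
  obtain ⟨s₂, h2⟩ := exists_nat_ge ((4 * K + 4) * 2 / d)
  refine ⟨max s₁ s₂, fun s hs' y z g N D hN hD hy hz hg => ?_⟩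
  have hΓ : discountNorm γ (h.length + 1 + s) < d / 8 :=
    h1 _ ((le_max_left _ _).trans (hs'.le.trans (Nat.le_add_left _ _)))
  have hs2 : (s₂ : ℝ) ≤ s := by exact_mod_cast (le_max_right _ _).trans hs'
  have h3 : (4 * (K : ℝ) + 4) * 2 ≤ d * s := by
    rw [div_le_iff₀ hd0] at h2
    nlinarith
  have hN' : (N : ℝ) = (s + 1) * (s + 1) := by rw [hN]; push_cast; ring
  have hD' : (D : ℝ) = (s + 1) * K := by rw [hD]; push_cast; ring
  have hN0 : (0 : ℝ) < N := by rw [hN']; positivity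
  have ha := mul_le_mul_of_nonneg_left (actionValue_horizonValue_mem hγ hs hr s hh a).2 hN0.le
  have hb := mul_le_mul_of_nonneg_left (actionValue_horizonValue_mem hγ hs hr s hh b).1 hN0.le
  have hΓN := mul_lt_mul_of_pos_left hΓ hN0
  have hs0 : (0 : ℝ) ≤ s := s.cast_nonneg
  have hK0 : (0 : ℝ) ≤ K := K.cast_nonneg
  have h4 : 8 * (D : ℝ) + 8 ≤ N * d := by
    have e1 : (s + 1 : ℝ) * ((4 * K + 4) * 2) ≤ (s + 1) * (d * (s + 1)) :=
      mul_le_mul_of_nonneg_left (by nlinarith) (by positivity)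
    rw [hD', hN']
    nlinarith
  have hD0 : (0 : ℝ) ≤ D := D.cast_nonneg
  have h5 : (N : ℝ) * d = N * actionValue γ r ν (optimalValue γ r ν) h a -
      N * actionValue γ r ν (optimalValue γ r ν) h b := by rw [hd]; ring
  rw [abs_le] at *
  have : (z : ℝ) + 2 * D + g + 2 < y := by linarith
  exact_mod_cast this

variable [Primcodable A] [Primcodable E] {O : Oracle A E}

/-- The admissible approximations of the value of `a` at `h` at stage `s` of a comparison: the
horizon is `s`, the unit is `1 / (s + 1) ^ 2`. -/
def stageApprox (γ : ℕ → ℝ) (r : E → ℝ) (ν : Environment A E) (K s : ℕ) (h : List (A × E))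
    (a : A) : Set ℕ :=
  {y | |(y : ℝ) - ((s + 1) * (s + 1) : ℕ) * actionValue γ r ν (horizonValue γ r ν s) h a| ≤
    ((s + 1) * K : ℕ)}

theorem computable_stagePrecision : Computable fun s : ℕ => s * s + 2 * s :=
  (Primrec.nat_add.comp (Primrec.nat_mul.comp Primrec.id Primrec.id)
    (Primrec.nat_mul.comp (Primrec.const 2) Primrec.id)).to_comp

theorem oracleSolvable_stageApprox (hγ : ∀ t, 0 ≤ γ t) (hs : Summable γ)
    (hr : ∀ e, 0 ≤ r e ∧ r e ≤ 1) (hr_est : Estimable r)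
    (hΓ_est : Estimable (discountNorm γ)) (hν : ν.OEstimableConditionals O) [Nonempty A] :
    ∃ K : ℕ, ∀ a, OracleSolvable O {p : ℕ × List (A × E) | p.2 ∈ ν.dom}
      fun p => stageApprox γ r ν K p.1 p.2 a := by
  obtain ⟨K, hK⟩ := oracleSolvable_actionValue hγ hs hr hr_est hΓ_est hν
  refine ⟨K, fun a => ((hK a).comp (f := fun p : ℕ × List (A × E) =>
    (p.1, p.1 * p.1 + 2 * p.1, p.2)) (Computable.fst.pair
      ((computable_stagePrecision.comp Computable.fst).pair Computable.snd))
    fun p hp => hp).mono subset_rfl ?_⟩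
  rintro ⟨s, h⟩ - y hy
  have hk : s * s + 2 * s + 1 = (s + 1) * (s + 1) := by ring
  simp only [Set.mem_ofPred_eq, hk, ← Nat.cast_mul] at hy
  exact hy

/-- A machine that finds the better one of two actions of different values. -/
theorem exists_comparison (hγ : ∀ t, 0 ≤ γ t) (hs : Summable γ)
    (hr : ∀ e, 0 ≤ r e ∧ r e ≤ 1) (hr_est : Estimable r)
    (hΓ_est : Estimable (discountNorm γ)) (hν : ν.OEstimableConditionals O) [Nonempty A]
    (a b : A) :
    ∃ T : PTM, ∀ h ∈ ν.dom,
      (actionValue γ r ν (optimalValue γ r ν) h b < actionValue γ r ν (optimalValue γ r ν) h a →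
        T.Solves O (historyString h) ({.inl a} : Set (A ⊕ E))) ∧
      (actionValue γ r ν (optimalValue γ r ν) h a < actionValue γ r ν (optimalValue γ r ν) h b →
        T.Solves O (historyString h) ({.inl b} : Set (A ⊕ E))) := by
  obtain ⟨K, hK⟩ := oracleSolvable_stageApprox hγ hs hr hr_est hΓ_est hν
  obtain ⟨G, hG, hGΓ⟩ := hΓ_est.exists_fixedPoint (discountNorm_nonneg hγ)
  set Q := actionValue γ r ν (optimalValue γ r ν)
  -- Correct verdicts; the set is empty on a tie.
  let R : List (A × E) → Set (A ⊕ E) := fun h =>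
    {c | (Q h b < Q h a ∧ c = .inl a) ∨ (Q h a < Q h b ∧ c = .inl b)}
  let P : ℕ → List (A × E) → Set (ℕ × ℕ) := fun s h =>
    stageApprox γ r ν K s h a ×ˢ stageApprox γ r ν K s h b
  let g : ℕ → List (A × E) → ℕ := fun s h => G (h.length + 1 + s) (s * s + 2 * s)
  have hgΓ : ∀ s h, |(g s h : ℝ) - ((s + 1) * (s + 1) : ℕ) *
      discountNorm γ (h.length + 1 + s)| ≤ 2 := fun s h => by
    rw [show (s + 1) * (s + 1) = s * s + 2 * s + 1 by ring]
    exact_mod_cast hGΓ (h.length + 1 + s) (s * s + 2 * s)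
  let t : ℕ → List (A × E) → ℕ := fun s h => 2 * ((s + 1) * K) + g s h + 2
  have hdecided : ∀ h ∈ ν.dom, Q h a ≠ Q h b → ∃ s₀, ∀ s ≥ s₀, ∀ y z, (y, z) ∈ P s h →
      z + t s h < y ∨ y + t s h < z := by
    intro h hh hne
    rcases hne.lt_or_gt with hlt | hlt
    · obtain ⟨s₀, hs₀⟩ := exists_forall_approx_lt hγ hs hr hh K hlt
      refine ⟨s₀, fun s hss y z hP => .inr ?_⟩
      have := hs₀ s hss z y (g s h) _ _ rfl rfl hP.2 hP.1 (hgΓ s h)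
      simp only [t]
      omega
    · obtain ⟨s₀, hs₀⟩ := exists_forall_approx_lt hγ hs hr hh K hlt
      refine ⟨s₀, fun s hss y z hP => .inl ?_⟩
      have := hs₀ s hss y z (g s h) _ _ rfl rfl hP.1 hP.2 (hgΓ s h)
      simp only [t]
      omega
  -- Stage `s` works if all admissible estimates decide it, or if the machine called for stage `s +
  -- 1` succeeds.
  let D : Set (PTM × ℕ × List (A × E)) := {p | p.2.2 ∈ ν.dom ∧
    ((∀ y z, (y, z) ∈ P p.2.1 p.2.2 → z + t p.2.1 p.2.2 < y ∨ y + t p.2.1 p.2.2 < z) ∨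
      p.1.Solves O (p.2.1 + 1, p.2.2) (R p.2.2))}
  have hps : Computable fun p : PTM × ℕ × List (A × E) => p.2.1 :=
    Computable.fst.comp Computable.snd
  have hph : Computable fun p : PTM × ℕ × List (A × E) => p.2.2 :=
    Computable.snd.comp Computable.snd
  have hest : OracleSolvable O D fun p => P p.2.1 p.2.2 :=
    ((hK a).prod (hK b)).comp Computable.snd fun p hp => hp.1
  have hmain : OracleSolvable O D fun p => R p.2.2 := by
    refine hest.bind (D' := {q : (PTM × ℕ × List (A × E)) × ℕ × ℕ | q.1 ∈ D ∧
      q.2 ∈ P q.1.2.1 q.1.2.2}) (R' := fun q => R q.1.2.2) ?_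
      fun p hp yz hyz => ⟨⟨hp, hyz⟩, subset_rfl⟩
    have hqs : Computable fun q : (PTM × ℕ × List (A × E)) × ℕ × ℕ => q.1.2.1 :=
      hps.comp Computable.fst
    have hqh : Computable fun q : (PTM × ℕ × List (A × E)) × ℕ × ℕ => q.1.2.2 :=
      hph.comp Computable.fst
    have hqt : Computable fun q : (PTM × ℕ × List (A × E)) × ℕ × ℕ => t q.1.2.1 q.1.2.2 := by
      refine Primrec.nat_add.to_comp.comp (Primrec.nat_add.to_comp.comp
        (Primrec.nat_mul.to_comp.comp (Computable.const 2) (Primrec.nat_mul.to_comp.comp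
          (Computable.succ.comp hqs) (Computable.const K))) ?_) (Computable.const 2)
      exact hG.comp (Primrec.nat_add.to_comp.comp
        (Computable.succ.comp (Computable.list_length.comp hqh)) hqs)
        (computable_stagePrecision.comp hqs)
    have hqy : Computable fun q : (PTM × ℕ × List (A × E)) × ℕ × ℕ => q.2.1 :=
      Computable.fst.comp Computable.snd
    have hqz : Computable fun q : (PTM × ℕ × List (A × E)) × ℕ × ℕ => q.2.2 :=
      Computable.snd.comp Computable.snd
    refine OracleSolvable.cond (c := fun q => decide (q.2.2 + t q.1.2.1 q.1.2.2 < q.2.1))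
      (Primrec.nat_lt.decide.to_comp.comp (Primrec.nat_add.to_comp.comp hqz hqt) hqy) ?_ ?_
    · refine .pure (Computable.const (.inl a)) ?_
      rintro ⟨⟨T, s, h⟩, y, z⟩ ⟨⟨hD, hP⟩, hlt⟩
      have hlt : z + t s h < y := of_decide_eq_true hlt
      refine .inl ⟨actionValue_lt_of_approx hγ hs hr hD.1 hP.1 hP.2 (hgΓ s h) ?_, rfl⟩
      simp only [t] at hlt
      change z + 2 * ((s + 1) * K) + g s h + 2 < y
      omega
    refine OracleSolvable.cond (c := fun q => decide (q.2.1 + t q.1.2.1 q.1.2.2 < q.2.2))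
      (Primrec.nat_lt.decide.to_comp.comp (Primrec.nat_add.to_comp.comp hqy hqt) hqz) ?_ ?_
    · refine .pure (Computable.const (.inl b)) ?_
      rintro ⟨⟨T, s, h⟩, y, z⟩ ⟨⟨⟨hD, hP⟩, -⟩, hlt⟩
      have hlt : y + t s h < z := of_decide_eq_true hlt
      refine .inr ⟨actionValue_lt_of_approx hγ hs hr hD.1 hP.2 hP.1 (hgΓ s h) ?_, rfl⟩
      simp only [t] at hlt
      change y + 2 * ((s + 1) * K) + g s h + 2 < z
      omega
    · refine .call (s := fun q => q.1.1) (Computable.fst.comp Computable.fst)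
        (f := fun q => (q.1.2.1 + 1, q.1.2.2)) ((Computable.succ.comp hqs).pair hqh) ?_
      rintro ⟨⟨T, s, h⟩, y, z⟩ ⟨⟨⟨hD, hP⟩, h1⟩, h2⟩
      have h1 : ¬z + t s h < y := of_decide_eq_false h1
      have h2 : ¬y + t s h < z := of_decide_eq_false h2
      rcases hD.2 with h3 | h3
      · exact absurd (h3 y z hP) (not_or.2 ⟨h1, h2⟩)
      · exact h3
  obtain ⟨T, hT⟩ := hmain.recursion
  have hloop : ∀ h ∈ ν.dom, Q h a ≠ Q h b → ∀ s : ℕ, T.Solves O (s, h) (R h) := by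
    intro h hh hne s
    obtain ⟨s₀, hs₀⟩ := hdecided h hh hne
    rcases le_total s₀ s with hle | hle
    · exact hT (s, h) ⟨hh, .inl (hs₀ s hle)⟩
    -- From `s₀` on every stage decides. Below `s₀`, whether a stage decides may depend on the
    -- random estimates; but a verdict is always correct, and otherwise the next stage takes over,
    -- hence induction downwards from `s₀`.
    · refine Nat.decreasingInduction (motive := fun s _ => T.Solves O (s, h) (R h))
        (fun s _ ih => hT (s, h) ⟨hh, .inr ih⟩) (hT (s₀, h) ⟨hh, .inl (hs₀ s₀ le_rfl)⟩) hle
  have hfinal : OracleSolvable O {x : List (A ⊕ E) | parseHistory x ∈ ν.dom ∧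
      Q (parseHistory x) a ≠ Q (parseHistory x) b} fun x => R (parseHistory x) :=
    .call (s := fun _ => T) (Computable.const T) (f := fun x => (0, parseHistory x))
      ((Computable.const 0).pair computable_parseHistory) fun x hx => hloop _ hx.1 hx.2 0
  obtain ⟨U, hU⟩ := hfinal
  refine ⟨U, fun h hh => ⟨fun hlt => ?_, fun hlt => ?_⟩⟩
  · have := hU (historyString h) (by simpa [parseHistory_historyString] using ⟨hh, hlt.ne'⟩)
    simp only [parseHistory_historyString] at this
    refine this.mono ?_
    rintro c (hc | hc)
    · exact hc.2
    · exact absurd hc.1 hlt.asymm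
  · have := hU (historyString h) (by simpa [parseHistory_historyString] using ⟨hh, hlt.ne⟩)
    simp only [parseHistory_historyString] at this
    refine this.mono ?_
    rintro c (hc | hc)
    · exact absurd hc.1 hlt.asymm
    · exact hc.2

end Comparison

/-! ## The optimal strategy -/

section Tournament

variable {A E : Type*} [Fintype A] [Primcodable A] [Primcodable E] {O : Oracle A E}

/-- The code `(1, 1)` stands for `1/2`. Almost sure output `a` forces `q a ≥ 1`, above the
threshold. -/
theorem answerProb_half_eq_one (hO : O.IsReflective) {T : PTM} {x : List (A ⊕ E)} {a : A}
    (h : T.Solves O x ({.inl a} : Set (A ⊕ E))) : O.answerProb (T, x, (1, 1), a) = 1 := by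
  obtain ⟨q, -, hq⟩ := hO T x
  have h1 : lam O T (.inl a) x = 1 := by rw [lam, ← Set.image_singleton]; exact h
  refine ((hq a).2.2 _).1 (lt_of_lt_of_le ?_ (h1.symm.le.trans (hq a).1))
  have : ratOfCode (1, 1) ∈ Set.Icc (0 : ℚ) 1 := by norm_num [ratOfCode]
  rw [Set.projIcc_of_mem _ this]
  norm_num [ratOfCode]

/-- Almost sure output `b` leaves no probability for `a`: the upper bound in reflectivity gives `q a
≤ 0`, below the threshold. -/
theorem answerProb_half_eq_zero (hO : O.IsReflective) {T : PTM} {x : List (A ⊕ E)} {a b : A}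
    (hab : b ≠ a) (h : T.Solves O x ({.inl b} : Set (A ⊕ E))) :
    O.answerProb (T, x, (1, 1), a) = 0 := by
  classical
  obtain ⟨q, -, hq⟩ := hO T x
  have h1 : lam O T (.inl b) x = 1 := by rw [lam, ← Set.image_singleton]; exact h
  have h2 := Finset.single_le_sum (f := fun c => lam O T (.inl c) x)
    (fun c _ => haltProb_nonneg T _ _) (Finset.mem_erase.2 ⟨hab, Finset.mem_univ b⟩)
  have h3 := (hq a).2.1
  refine ((hq a).2.2 _).2 ?_
  have : ratOfCode (1, 1) ∈ Set.Icc (0 : ℚ) 1 := by norm_num [ratOfCode]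
  rw [Set.projIcc_of_mem _ this]
  refine lt_of_le_of_lt (b := 0) ?_ (by norm_num [ratOfCode])
  simp only [h1] at h2
  refine h3.trans ?_
  convert sub_nonpos.2 h2

variable [Fintype E] {γ : ℕ → ℝ} {r : E → ℝ} {ν : Environment A E}

/-- Some machine always halts with an action which, at the histories in `ν.dom`, is of maximal
value among the given ones. -/
theorem oracleSolvable_maximal (hO : O.IsReflective) (hγ : ∀ t, 0 ≤ γ t) (hs : Summable γ)
    (hr : ∀ e, 0 ≤ r e ∧ r e ≤ 1) (hr_est : Estimable r)
    (hΓ_est : Estimable (discountNorm γ)) (hν : ν.OEstimableConditionals O) [Nonempty A]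
    (l : List A) (hl : l ≠ []) :
    OracleSolvable O Set.univ fun x : List (A ⊕ E) => {c : A | ∀ h ∈ ν.dom, historyString h = x →
      ∀ b ∈ l, actionValue γ r ν (optimalValue γ r ν) h b ≤
        actionValue γ r ν (optimalValue γ r ν) h c} := by
  choose T hT using exists_comparison hγ hs hr hr_est hΓ_est hν
  induction l with
  | nil => exact absurd rfl hl
  | cons a l ih =>
    by_cases hl' : l = []
    · subst hl'
      exact .pure (Computable.const a) fun x _ h _ _ b hb => by simp [List.mem_singleton.1 hb]
    -- The current winner `p.2` meets the new action `a`. The comparison machine is found from a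
    -- finite table indexed by actions.
    have hq : Computable fun p : List (A ⊕ E) × A => (T a p.2, p.1, ((1 : ℤ), (1 : ℕ)), a) :=
      ((Primrec.dom_finite (T a)).to_comp.comp Computable.snd).pair
        (Computable.fst.pair ((Computable.const _).pair (Computable.const a)))
    have hf : Computable fun q : (List (A ⊕ E) × A) × Bool => bif q.2 then a else q.1.2 :=
      Computable.cond Computable.snd (Computable.const a) (Computable.snd.comp Computable.fst)
    refine (ih hl').bind (D' := {p | ∀ h ∈ ν.dom, historyString h = p.1 → ∀ b ∈ l,
        actionValue γ r ν (optimalValue γ r ν) h b ≤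
          actionValue γ r ν (optimalValue γ r ν) h p.2})
      (R' := fun p => {c : A | ∀ h ∈ ν.dom, historyString h = p.1 → ∀ b ∈ a :: l,
        actionValue γ r ν (optimalValue γ r ν) h b ≤
          actionValue γ r ν (optimalValue γ r ν) h c}) ?_ fun x _ c hc => ⟨hc, subset_rfl⟩
    refine ((OracleSolvable.query hq).mono (Set.subset_univ _) fun _ _ => subset_rfl).map
      (f := fun q => bif q.2 then a else q.1.2) hf ?_
    -- An answer of positive probability is never the wrong one for a strict inequality: the
    -- previous two lemmas would give that answer probability zero. Hence the declared winner is at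
    -- least as good as the loser.
    rintro ⟨x, c⟩ hc d (⟨rfl, hd⟩ | ⟨rfl, hd⟩) h hh hx b hb
    · have hle : actionValue γ r ν (optimalValue γ r ν) h c ≤
          actionValue γ r ν (optimalValue γ r ν) h a := by
        by_contra! hlt
        refine hd (answerProb_half_eq_zero hO (b := c) ?_ (hx ▸ (hT a c h hh).2 hlt))
        rintro rfl
        exact lt_irrefl _ hlt
      rcases List.mem_cons.1 hb with rfl | hb
      · exact le_rfl
      · exact (hc h hh hx b hb).trans hle
    · have hle : actionValue γ r ν (optimalValue γ r ν) h a ≤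
          actionValue γ r ν (optimalValue γ r ν) h c := by
        by_contra! hlt
        exact hd (answerProb_half_eq_one hO (hx ▸ (hT a c h hh).1 hlt))
      rcases List.mem_cons.1 hb with rfl | hb
      · exact hle
      · exact hc h hh hx b hb

end Tournament

theorem mainTheorem5 {A E : Type*} [Fintype A] [Primcodable A] [Fintype E] [Primcodable E]
    (O : Oracle A E) (hO : O.IsReflective)
    (r : E → ℝ) (hr : ∀ e, 0 ≤ r e ∧ r e ≤ 1) (hr_est : Estimable r)
    (γ : ℕ → ℝ) (hγ : ∀ t, 0 ≤ γ t) (hγ_sum : Summable γ) (hΓ_est : Estimable (discountNorm γ))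
    (ν : Environment A E) (hν : ν.OEstimableConditionals O) :
    ∃ π : Strategy A E, π.IsReflectiveOracleComputable O ∧ π.IsOptimal γ r ν := by
  classical
  -- With no actions the numbers `q` of reflectivity would have the empty sum `0` instead of `1`.
  have hA : Nonempty A := by
    obtain ⟨q, hq, -⟩ := hO Nat.Partrec.Code.zero []
    by_contra h
    rw [not_nonempty_iff] at h
    simp at hq
  obtain ⟨T, hT⟩ := (oracleSolvable_maximal hO hγ hγ_sum hr hr_est hΓ_est hν
    (Finset.univ : Finset A).toList (by simp [Finset.univ_nonempty.ne_empty])).map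
    (f := fun q => (Sum.inl q.2 : A ⊕ E))
    (R' := fun x => Sum.inl '' {c : A | ∀ h ∈ ν.dom, historyString h = x → ∀ b : A,
      actionValue γ r ν (optimalValue γ r ν) h b ≤ actionValue γ r ν (optimalValue γ r ν) h c})
    (Computable.sumInl.comp Computable.snd)
    fun x _ c hc => ⟨c, fun h hh hx b => hc h hh hx b (by simp), rfl⟩
  have hdisj : ∀ s : Set A, s.PairwiseDisjoint
      fun c => ({Encodable.encode (Sum.inl c : A ⊕ E)} : Set ℕ) := fun s c _ d _ hcd => by
    simpa using hcd
  have hsum : ∀ h (s : Finset A), haltProb O T (Encodable.encode (historyString h))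
      (Encodable.encode '' (Sum.inl '' (s : Set A) : Set (A ⊕ E))) =
        ∑ c ∈ s, lam O T (.inl c) (historyString h) := by
    intro h s
    simp only [lam]
    rw [← haltProb_sum s T _ _ (hdisj s)]
    congr 1
    ext m
    simp [eq_comm]
  have hone : ∀ h (s : Finset A), {c : A | ∀ h' ∈ ν.dom, historyString h' = historyString h →
      ∀ b : A, actionValue γ r ν (optimalValue γ r ν) h' b ≤
        actionValue γ r ν (optimalValue γ r ν) h' c} ⊆ s →
      ∑ c ∈ s, lam O T (.inl c) (historyString h) = 1 := by
    intro h s hsub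
    rw [← hsum]
    exact (hT (historyString h) (Set.mem_univ _)).mono (Set.image_mono hsub)
  refine ⟨⟨fun h a => lam O T (.inl a) (historyString h), fun h a => haltProb_nonneg T _ _,
    fun h => hone h Finset.univ (by simp)⟩, ⟨T, fun _ _ => rfl⟩,
    Strategy.isOptimal_of_greedy hγ hγ_sum hr fun h hh a ha b => ?_⟩
  by_contra hlt
  refine ha ?_
  have h1 := hone h Finset.univ (by simp)
  -- If `a` is not a maximizer, the remaining actions already carry all the probability, so `a` is
  -- played with probability zero.
  have h2 := hone h (Finset.univ.erase a) fun c hc => by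
    simp only [Finset.coe_erase, Finset.coe_univ, Set.mem_sdiff, Set.mem_univ, true_and,
      Set.mem_singleton_iff]
    rintro rfl
    exact hlt (hc h hh rfl b)
  rw [← Finset.add_sum_erase _ _ (Finset.mem_univ a), h2] at h1
  linarith
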